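/- Units are such that $k_B=1$. Let $\hslash,\omega_D>0$, $0<\varepsilon<\hslash\omega_D<\mu$, and put $I=[\varepsilon,\hslash\omega_D]$. Let $0<U_1<U_2$ and let $U\in C^2(I^2)$ satisfy $U_1\le U(x,\xi)\le U_2$ on $I^2$. Let $N\colon[-\mu,\infty)\to[0,\infty)$ be continuous with $N_0:=N(0)>0$ and $N(x)=O(\sqrt x)$ as $x\to\infty$. Below, $\tanh\frac{E}{2T}$ with $E>0$ is read as $1$ when $T=0$. *Simplified gaps.* Assume that there is a $\tau_1>0$ with $1=U_1\int_\varepsilon^{\hslash\omega_D}\frac1\xi\tanh\frac{\xi}{2\tau_1}\,d\xi$. For $i=1,2$ and $T\ge 0$ let $\Delta_i(T)$ be the nonnegative number with $$1=U_i\int_\varepsilon^{\hslash\omega_D}\frac{1}{\sqrt{\xi^2+\Delta_i(T)^2}}\tanh\frac{\sqrt{\xi^2+\Delta_i(T)^2}}{2T}\,d\xi$$ if it exists (it is then unique), and $\Delta_i(T)=0$ otherwise. *Transition temperature.* Let $V_T$ be the set of $\varphi\in C(I)$ with $\Delta_1(T)\le\varphi\le\Delta_2(T)$ on $I$, and let $u_0(T,\cdot)\in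 V_T$ be the solution of the BCS gap equation $$u_0(T,x)=\int_\varepsilon^{\hslash\omega_D}\frac{U(x,\xi)\,u_0(T,\xi)}{\sqrt{\xi^2+u_0(T,\xi)^2}}\tanh\frac{\sqrt{\xi^2+u_0(T,\xi)^2}}{2T}\,d\xi,\qquad x\in I,$$ where the solution $0$ is disregarded if $V_T$ contains a solution that is not identically zero. Put $T_c=\inf\{T>0:\ u_0(T,x)=0\text{ for all }x\in I\}$. *The set $W$.* Let $W$ be the set of $u\in C([0,T_c]\times I)\cap C^2((0,T_c)\times I)$ with $\Delta_1(T)\le u(T,x)\le\Delta_2(T)$ on $[0,T_c]\times I$ that satisfy condition (C): there are unique $v,w\in C(I)$ such that $v>0$ on $I$ and, with $f=u^2$, as $T\uparrow T_c$, uniformly in $x\in I$, $$\frac{u(T,x)^2}{T_c-T}\to v(x),\qquad 2u(T,x)\frac{\partial u}{\partial T}(T,x)\to -v(x),$$ $$\frac{f(T,x)+(T_c-T)\frac{\partial f}{\partial T}(T,x)}{(T_c-T)^2}\to-\frac{w(x)}2,\qquad \frac{\partial^2 f}{\partial T^2}(T,x)\to w(x).$$ *Thermodynamic potential.* For $T>0$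 and $u\in W$ let $$\Omega_N(T)=-2N_0\int_\varepsilon^{\hslash\omega_D}x\,dx-4N_0T\int_\varepsilon^{\hslash\omega_D}\ln(1+e^{-x/T})\,dx+\Phi(T),$$ $$\Phi(T)=2\int_{-\mu}^{-\hslash\omega_D}xN(x)\,dx-2T\int_{-\mu}^{-\hslash\omega_D}N(x)\ln(1+e^{x/T})\,dx-2T\int_{\hslash\omega_D}^\infty N(x)\ln(1+e^{-x/T})\,dx,$$ and, with $E(T,x)=\sqrt{x^2+u(T,x)^2}$, $$\Psi(T)=-2N_0\int_\varepsilon^{\hslash\omega_D}(E-x)\,dx+N_0\int_\varepsilon^{\hslash\omega_D}\frac{u^2}{E}\tanh\frac{E}{2T}\,dx-4N_0T\int_\varepsilon^{\hslash\omega_D}\ln\frac{1+e^{-E/T}}{1+e^{-x/T}}\,dx\qquad(0<T\le T_c).$$ Put $\Omega=\Omega_N+\Psi$ for $0<T\le T_c$ and $\Omega=\Omega_N$ for $T>T_c$. (This is the thermodynamic potential in which the gap function $u_0$ is replaced by $u\in W$.) **Theorem.** Let $u\in W$, let $v$ be as in condition (C), and let $\Omega$ be formed with $u$. (a) The transition at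 $T_c$ is a second-order phase transition: $\Omega$ is of class $C^1$ on $(0,\infty)$ and of class $C^2$ on $(0,\infty)\setminus\{T_c\}$, and $\partial^2\Omega/\partial T^2$ is discontinuous at $T_c$ (no value at $T_c$ makes it continuous there). Consequently, if the solution $u_0$ of the BCS gap equation (for $0\le T\le T_c$) itself belongs to $W$, then the transition for the potential formed with $u_0$ is a second-order phase transition. (b) With $C_V=-T\,\partial^2\Omega/\partial T^2$, both one-sided limits of $C_V$ at $T_c$ exist, and $$\Delta C_V:=\lim_{T\uparrow T_c}C_V(T)-\lim_{T\downarrow T_c}C_V(T)=-\frac{N_0}{8T_c}\int_{\varepsilon/(2T_c)}^{\hslash\omega_D/(2T_c)}v(2T_c\eta)^2\,g(\eta)\,d\eta>0,$$ where $g(\eta)=\frac1{\eta^2}\left(\frac1{\cosh^2\eta}-\frac{\tanh\eta}{\eta}\right)$ for $\eta>0$ and $g(0)=-\frac23$. -/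

import Mathlib

namespace BCS

noncomputable section

/-! Throughout, `k_B = 1`, `ε` is the lower cutoff, `Λ` stands for `ℏ ω_D`, the temperature is
`T ≥ 0`, and functions of `x` (or of `(T, x)`) are functions on `ℝ` (or `ℝ × ℝ`) of which only
the values for `x ∈ [ε, Λ]` are used. -/

/-- `tanh (E / (2 T))`, where for `T = 0` (and `E > 0`) the limit value `1` as `T ↓ 0` is meant. -/
def thermalTanh (E T : ℝ) : ℝ :=
  if T = 0 then 1 else Real.tanh (E / (2 * T))

/-- `τ > 0` is the transition temperature of the simplified gap equation with the constant
potential `V`: `1 = V ∫_ε^Λ ξ⁻¹ tanh (ξ / (2 τ)) dξ`. -/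
def IsSimpleTransitionTemp (ε Λ V τ : ℝ) : Prop :=
  0 < τ ∧ 1 = V * ∫ ξ in ε..Λ, 1 / ξ * Real.tanh (ξ / (2 * τ))

/-- `d` is a nonnegative solution, at temperature `T`, of the simplified gap equation with the
constant potential `V`. -/
def SolvesSimpleGap (ε Λ V T d : ℝ) : Prop :=
  0 ≤ d ∧
    1 = V * ∫ ξ in ε..Λ, 1 / Real.sqrt (ξ ^ 2 + d ^ 2) * thermalTanh (Real.sqrt (ξ ^ 2 + d ^ 2)) T

open Classical in
/-- The gap function `Δ` for the constant potential `V`: its value at `T` is the (only) nonnegative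
solution of the simplified gap equation at `T`, and `0` where there is none, that is, above the
transition temperature. -/
def simpleGap (ε Λ V T : ℝ) : ℝ :=
  if h : ∃ d, SolvesSimpleGap ε Λ V T d then h.choose else 0

/-- The condition on the potential: `U₁ ≤ U ≤ U₂` on `[ε, Λ]²` and `U ∈ C²([ε, Λ]²)`. -/
def PotentialCondition (ε Λ U₁ U₂ : ℝ) (U : ℝ → ℝ → ℝ) : Prop :=
  (∀ x ∈ Set.Icc ε Λ, ∀ ξ ∈ Set.Icc ε Λ, U₁ ≤ U x ξ ∧ U x ξ ≤ U₂) ∧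
    ContDiffOn ℝ 2 (Function.uncurry U) (Set.Icc ε Λ ×ˢ Set.Icc ε Λ)

/-- The set `V_T` of continuous functions on `[ε, Λ]` with values between `Δ₁(T)` and `Δ₂(T)`. -/
def VSet (ε Λ U₁ U₂ T : ℝ) : Set (ℝ → ℝ) :=
  {φ | ContinuousOn φ (Set.Icc ε Λ) ∧
    ∀ x ∈ Set.Icc ε Λ, simpleGap ε Λ U₁ T ≤ φ x ∧ φ x ≤ simpleGap ε Λ U₂ T}

/-- `φ` solves the BCS gap equation at temperature `T`. -/
def SolvesGapEquation (ε Λ : ℝ) (U : ℝ → ℝ → ℝ) (T : ℝ) (φ : ℝ → ℝ) : Prop :=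
  ∀ x ∈ Set.Icc ε Λ,
    φ x = ∫ ξ in ε..Λ, U x ξ * φ ξ / Real.sqrt (ξ ^ 2 + φ ξ ^ 2) *
      thermalTanh (Real.sqrt (ξ ^ 2 + φ ξ ^ 2)) T

/-- `φ` is the solution `u₀(T, ·) ∈ V_T` of the BCS gap equation at temperature `T`. The zero
solution is disregarded if `V_T` contains a solution that is not identically zero. -/
def IsGapFunctionAt (ε Λ U₁ U₂ : ℝ) (U : ℝ → ℝ → ℝ) (T : ℝ) (φ : ℝ → ℝ) : Prop :=
  (φ ∈ VSet ε Λ U₁ U₂ T ∧ SolvesGapEquation ε Λ U T φ) ∧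
    ∀ ψ ∈ VSet ε Λ U₁ U₂ T, SolvesGapEquation ε Λ U T ψ →
      (∃ x ∈ Set.Icc ε Λ, ψ x ≠ 0) → ∃ x ∈ Set.Icc ε Λ, φ x ≠ 0

/-- The transition temperature `T_c`: the infimum of all `T > 0` at which the solution `u₀(T, ·)`
of the BCS gap equation vanishes identically on `[ε, Λ]`. -/
def transitionTemp (ε Λ U₁ U₂ : ℝ) (U : ℝ → ℝ → ℝ) : ℝ :=
  sInf {T | 0 < T ∧ ∃ φ, IsGapFunctionAt ε Λ U₁ U₂ U T φ ∧ ∀ x ∈ Set.Icc ε Λ, φ x = 0}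

/-- The functions `v`, `w` describe the behavior of `u` as `T ↑ T_c` in the sense of (C1), (C2)
and (C3) of condition (C). -/
def ConditionC (ε Λ Tc : ℝ) (u : ℝ → ℝ → ℝ) (v w : ℝ → ℝ) : Prop :=
  ContinuousOn v (Set.Icc ε Λ) ∧ ContinuousOn w (Set.Icc ε Λ) ∧
  (∀ x ∈ Set.Icc ε Λ, 0 < v x) ∧
  (∀ ε₁ > 0, ∃ δ > 0, ∀ T ∈ Set.Ioo 0 Tc, |Tc - T| < δ → ∀ x ∈ Set.Icc ε Λ,
    |v x - u T x ^ 2 / (Tc - T)| < Tc * ε₁ ∧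
    |v x + 2 * u T x * deriv (fun t => u t x) T| < Tc * ε₁) ∧
  (∀ ε₁ > 0, ∃ δ > 0, ∀ T ∈ Set.Ioo 0 Tc, |Tc - T| < δ → ∀ x ∈ Set.Icc ε Λ,
    |w x / 2 + (u T x ^ 2 + (Tc - T) * deriv (fun t => u t x ^ 2) T) / (Tc - T) ^ 2| < ε₁ ∧
    |w x - deriv (deriv (fun t => u t x ^ 2)) T| < ε₁)

/-- The set `W`: functions in `C([0, T_c] × [ε, Λ]) ∩ C²((0, T_c) × [ε, Λ])` between `Δ₁` and `Δ₂`
for which there are unique `v, w ∈ C([ε, Λ])` as in condition (C). -/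
def WSet (ε Λ U₁ U₂ Tc : ℝ) : Set (ℝ → ℝ → ℝ) :=
  {u | ContinuousOn (Function.uncurry u) (Set.Icc 0 Tc ×ˢ Set.Icc ε Λ) ∧
    ContDiffOn ℝ 2 (Function.uncurry u) (Set.Ioo 0 Tc ×ˢ Set.Icc ε Λ) ∧
    (∀ T ∈ Set.Icc 0 Tc, ∀ x ∈ Set.Icc ε Λ,
      simpleGap ε Λ U₁ T ≤ u T x ∧ u T x ≤ simpleGap ε Λ U₂ T) ∧
    ∃ v w, ConditionC ε Λ Tc u v w ∧
      ∀ v' w', ConditionC ε Λ Tc u v' w' →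
        Set.EqOn v' v (Set.Icc ε Λ) ∧ Set.EqOn w' w (Set.Icc ε Λ)}

/-- The part `Φ` of the normal-state potential that comes from energies outside `[-Λ, Λ]`; `N` is
the density of states. -/
def Phi (Λ μ : ℝ) (N : ℝ → ℝ) (T : ℝ) : ℝ :=
  2 * (∫ x in (-μ)..(-Λ), x * N x)
    - 2 * T * (∫ x in (-μ)..(-Λ), N x * Real.log (1 + Real.exp (x / T)))
    - 2 * T * ∫ x in Set.Ioi Λ, N x * Real.log (1 + Real.exp (-x / T))

/-- The normal-state potential `Ω_N`, with `N₀ = N 0`. -/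
def OmegaN (ε Λ μ : ℝ) (N : ℝ → ℝ) (T : ℝ) : ℝ :=
  -2 * N 0 * (∫ x in ε..Λ, x)
    - 4 * N 0 * T * (∫ x in ε..Λ, Real.log (1 + Real.exp (-x / T)))
    + Phi Λ μ N T

/-- The difference `Ψ` between superconducting-state and normal-state potential for the gap
function `u`. -/
def Psi (ε Λ : ℝ) (N : ℝ → ℝ) (u : ℝ → ℝ → ℝ) (T : ℝ) : ℝ :=
  -2 * N 0 * (∫ x in ε..Λ, (Real.sqrt (x ^ 2 + u T x ^ 2) - x))
    + N 0 * (∫ x in ε..Λ, u T x ^ 2 / Real.sqrt (x ^ 2 + u T x ^ 2) *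
        Real.tanh (Real.sqrt (x ^ 2 + u T x ^ 2) / (2 * T)))
    - 4 * N 0 * T * ∫ x in ε..Λ,
        Real.log ((1 + Real.exp (-Real.sqrt (x ^ 2 + u T x ^ 2) / T)) / (1 + Real.exp (-x / T)))

/-- The thermodynamic potential `Ω` with gap function `u`: `Ω_S = Ω_N + Ψ` for `0 < T ≤ T_c` and
`Ω_N` for `T > T_c`. -/
def Omega (ε Λ μ : ℝ) (N : ℝ → ℝ) (Tc : ℝ) (u : ℝ → ℝ → ℝ) (T : ℝ) : ℝ :=
  if T ≤ Tc then OmegaN ε Λ μ N T + Psi ε Λ N u T else OmegaN ε Λ μ N T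

/-- Second-order phase transition at `Tc`: `Ω` is `C¹` on `(0, ∞)` and `C²` on `(0, ∞) \ {Tc}`, and
the second derivative is discontinuous at `Tc`, in the sense that it has no (finite) limit there,
so that no value at `Tc` makes it continuous. -/
def IsSecondOrderTransition (Ω : ℝ → ℝ) (Tc : ℝ) : Prop :=
  ContDiffOn ℝ 1 Ω (Set.Ioi 0) ∧
  ContDiffOn ℝ 2 Ω (Set.Ioi 0 \ {Tc}) ∧
  ¬ ∃ L, Filter.Tendsto (deriv (deriv Ω)) (nhdsWithin Tc {Tc}ᶜ) (nhds L)

/-- The specific heat at constant volume `C_V = -T ∂²Ω/∂T²`. -/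
def specificHeat (Ω : ℝ → ℝ) (T : ℝ) : ℝ :=
  -T * deriv (deriv Ω) T

/-- The one-sided limits of `C_V` at `Tc` exist, and (limit from below) - (limit from above) is
the gap `J`. -/
def HasSpecificHeatGap (Ω : ℝ → ℝ) (Tc J : ℝ) : Prop :=
  ∃ CS CN : ℝ,
    Filter.Tendsto (specificHeat Ω) (nhdsWithin Tc (Set.Iio Tc)) (nhds CS) ∧
    Filter.Tendsto (specificHeat Ω) (nhdsWithin Tc (Set.Ioi Tc)) (nhds CN) ∧
    J = CS - CN

/-- The function `g` on `[0, ∞)`. -/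
def g (η : ℝ) : ℝ :=
  if η = 0 then -2 / 3
  else 1 / η ^ 2 * (1 / Real.cosh η ^ 2 - Real.tanh η / η)

/-- The value `-(N₀ / (8 T_c)) ∫_{ε/(2T_c)}^{Λ/(2T_c)} v(2 T_c η)² g(η) dη`. -/
def gapFormula (ε Λ N₀ Tc : ℝ) (v : ℝ → ℝ) : ℝ :=
  -(N₀ / (8 * Tc)) * ∫ η in (ε / (2 * Tc))..(Λ / (2 * Tc)), v (2 * Tc * η) ^ 2 * g η

end

end BCS

/-!
The transition is of second order because the condensation energy `Ψ` is of second order in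
the squared gap, and the squared gap vanishes linearly in `Tc - T` as `T ↑ Tc`.

With `A s = log (cosh √s)` (`logCoshSqrt`), `a = (x / (2 T))²` and `b = (x² + u²) / (4 T²)`, the
integrand of `Ψ` is `N 0` times `4 T (A a - A b + (b - a) A' b)` (`condensation_eq`). This divergence
vanishes to second order at `b = a`, that is, at vanishing gap. Condition (C) says that the squared
gap `u²` is `C²` in `T` up to `Tc` from the left, with value `0` and one-sided derivatives `-v` and
`w` there, uniformly in `x` (`exists_derivs_gap_sq`). Hence `Ψ` is `C²` up to `Tc` from the left,
`Ψ` and `Ψ'` vanish at `Tc`, and in `Ψ''` only the term `A'' (u²)'²` survives, in which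
`A'' s = g (√s) / 4` and `(u²)' = -v`; the substitution `x = 2 Tc η` turns `-Tc Ψ''` into the
formula for the gap of the specific heat (`exists_derivs_Psi`). It is positive since `g < 0`, which
is `2 η < sinh (2 η)` (`g_neg`).

The normal-state potential is `C²` on all of `(0, ∞)`, by differentiation under the integral sign
in the inverse temperature (`contDiffOn_OmegaN`). So `Ω` is a `C²` function plus the extension of
`Ψ` by `0` above `Tc`, whose second derivative jumps at `Tc`
(`secondOrderTransition_of_cutoff`). That `Tc > 0` follows from the uniqueness of `v` in the
definition of `W` (`pos_of_mem_WSet`).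
-/

namespace BCS

open Set Filter Topology MeasureTheory

/-! ### Integrals that depend on a parameter -/

theorem continuousOn_intervalIntegral {F : ℝ → ℝ → ℝ} {S : Set ℝ} {a b : ℝ} (hab : a ≤ b)
    (hF : ContinuousOn (Function.uncurry F) (S ×ˢ Icc a b)) :
    ContinuousOn (fun T => ∫ x in a..b, F T x) S := by
  rw [continuousOn_iff_continuous_domRestrict]
  have h : Continuous (Function.uncurry fun (T : S) x => F T (projIcc a b hab x)) := by
    have : Continuous fun p : S × ℝ => ((p.1 : ℝ), (projIcc a b hab p.2 : ℝ)) := by fun_prop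
    exact hF.comp_continuous this fun p => ⟨p.1.2, (projIcc a b hab p.2).2⟩
  convert intervalIntegral.continuous_parametric_intervalIntegral_of_continuous'
    (μ := volume) h a b using 1
  ext T
  refine intervalIntegral.integral_congr fun x hx => ?_
  rw [uIcc_of_le hab] at hx
  simp [projIcc_of_mem hab hx]

theorem continuousOn_slice {F : ℝ → ℝ → ℝ} {S I : Set ℝ}
    (hF : ContinuousOn (Function.uncurry F) (S ×ˢ I)) {T : ℝ} (hT : T ∈ S) :
    ContinuousOn (F T) I :=
  hF.comp (f := fun x => (T, x)) (by fun_prop) fun _ hx => ⟨hT, hx⟩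

theorem hasDerivAt_intervalIntegral {F F' : ℝ → ℝ → ℝ} {S : Set ℝ} {a b : ℝ} (hab : a ≤ b)
    (hS : IsOpen S) (hF : ContinuousOn (Function.uncurry F) (S ×ˢ Icc a b))
    (hF' : ContinuousOn (Function.uncurry F') (S ×ˢ Icc a b))
    (hd : ∀ T ∈ S, ∀ x ∈ Icc a b, HasDerivAt (fun t => F t x) (F' T x) T) {T : ℝ} (hT : T ∈ S) :
    HasDerivAt (fun T => ∫ x in a..b, F T x) (∫ x in a..b, F' T x) T := by
  obtain ⟨δ, hδ, hδS⟩ := Metric.nhds_basis_closedBall.mem_iff.1 (hS.mem_nhds hT)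
  obtain ⟨C, hC⟩ := ((isCompact_closedBall T δ).prod isCompact_Icc).exists_bound_of_continuousOn
    (hF'.mono (prod_mono hδS Subset.rfl))
  have hsub : uIoc a b ⊆ Icc a b := by rw [uIoc_of_le hab]; exact Ioc_subset_Icc_self
  have hmeas : ∀ {G : ℝ → ℝ → ℝ}, ContinuousOn (Function.uncurry G) (S ×ˢ Icc a b) → ∀ t ∈ S,
      AEStronglyMeasurable (G t) (volume.restrict (uIoc a b)) := fun hG t ht =>
    ((continuousOn_slice hG ht).mono hsub).aestronglyMeasurable measurableSet_uIoc
  refine (intervalIntegral.hasDerivAt_integral_of_dominated_loc_of_deriv_le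
    (bound := fun _ => C) (Metric.closedBall_mem_nhds T hδ) ?_ ?_ (hmeas hF' T hT) ?_ ?_ ?_).2
  · filter_upwards [hS.mem_nhds hT] with t ht using hmeas hF t ht
  · exact ((continuousOn_slice hF hT).mono (uIcc_of_le hab).subset).intervalIntegrable
  · exact .of_forall fun x hx t ht => hC (t, x) ⟨ht, hsub hx⟩
  · exact intervalIntegrable_const
  · exact .of_forall fun x hx t ht => hd t (hδS ht) x (hsub hx)

/-! ### The function `s ↦ log (cosh √s)` -/

/-- `A s = log (cosh √s)`. With `s = (E / (2 T))²` it carries the dependence of the free energy of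
a mode on the square of its energy `E`, a quantity in which the gap enters polynomially. -/
noncomputable def logCoshSqrt (s : ℝ) : ℝ := Real.log (Real.cosh (√s))

/-- The derivative of `logCoshSqrt` on `(0, ∞)`. -/
noncomputable def logCoshSqrt₁ (s : ℝ) : ℝ := Real.tanh (√s) / (2 * √s)

/-- The second derivative of `logCoshSqrt` on `(0, ∞)`. -/
noncomputable def logCoshSqrt₂ (s : ℝ) : ℝ := g (√s) / 4

theorem hasDerivAt_tanh (x : ℝ) : HasDerivAt Real.tanh (1 / Real.cosh x ^ 2) x := by
  have h := (Real.hasDerivAt_sinh x).div (Real.hasDerivAt_cosh x) (Real.cosh_pos x).ne'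
  have e : Real.tanh = fun x => Real.sinh x / Real.cosh x := funext Real.tanh_eq_sinh_div_cosh
  rw [e]
  refine h.congr_deriv ?_
  rw [← sq, ← sq, Real.cosh_sq_sub_sinh_sq]

theorem hasDerivAt_logCoshSqrt {s : ℝ} (hs : 0 < s) :
    HasDerivAt logCoshSqrt (logCoshSqrt₁ s) s := by
  have h := ((Real.hasDerivAt_cosh (√s)).comp s (Real.hasDerivAt_sqrt hs.ne')).log
    (Real.cosh_pos _).ne'
  refine h.congr_deriv ?_
  have := (Real.cosh_pos (√s)).ne'
  have := (Real.sqrt_pos.2 hs).ne'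
  simp only [logCoshSqrt₁, Real.tanh_eq_sinh_div_cosh, Function.comp]
  field_simp

theorem hasDerivAt_logCoshSqrt₁ {s : ℝ} (hs : 0 < s) :
    HasDerivAt logCoshSqrt₁ (logCoshSqrt₂ s) s := by
  have hq := Real.hasDerivAt_sqrt hs.ne'
  have h0 := (Real.sqrt_pos.2 hs).ne'
  have h := ((hasDerivAt_tanh (√s)).comp s hq).div (hq.const_mul 2) (by positivity)
  refine h.congr_deriv ?_
  have := (Real.cosh_pos (√s)).ne'
  simp only [logCoshSqrt₂, g, if_neg h0, Function.comp]
  field_simp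
  ring

theorem contDiff_tanh {n : WithTop ℕ∞} : ContDiff ℝ n Real.tanh := by
  have e : Real.tanh = fun x => Real.sinh x / Real.cosh x := funext Real.tanh_eq_sinh_div_cosh
  rw [e]
  exact Real.contDiff_sinh.div Real.contDiff_cosh fun x => (Real.cosh_pos x).ne'

theorem contDiffOn_g {n : WithTop ℕ∞} : ContDiffOn ℝ n g (Ioi 0) := by
  have h : ContDiffOn ℝ n
      (fun η : ℝ => 1 / η ^ 2 * (1 / Real.cosh η ^ 2 - Real.tanh η / η)) (Ioi 0) := by
    have h0 : ∀ η ∈ Ioi (0 : ℝ), η ≠ 0 := fun η h => ne_of_gt h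
    refine (contDiffOn_const.div (contDiffOn_id.pow 2) fun η h => pow_ne_zero 2 (h0 η h)).mul
      ((contDiffOn_const.div (Real.contDiff_cosh.contDiffOn.pow 2)
        fun η _ => pow_ne_zero 2 (Real.cosh_pos η).ne').sub
        (contDiff_tanh.contDiffOn.div contDiffOn_id h0))
  exact h.congr fun η hη => if_neg (ne_of_gt hη)

/-- The inequality `g η < 0` amounts to `2 η < sinh (2 η)`. -/
theorem g_neg {η : ℝ} (hη : 0 < η) : g η < 0 := by
  rw [g, if_neg hη.ne']
  refine mul_neg_of_pos_of_neg (by positivity) ?_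
  have hc := Real.cosh_pos η
  have h := Real.self_lt_sinh_iff.2 (show 0 < 2 * η by positivity)
  rw [Real.sinh_two_mul] at h
  rw [Real.tanh_eq_sinh_div_cosh, sub_neg, div_div, div_lt_div_iff₀ (by positivity) (by positivity)]
  nlinarith [mul_lt_mul_of_pos_right h hc]

theorem contDiffOn_logCoshSqrt₂ {n : WithTop ℕ∞} : ContDiffOn ℝ n logCoshSqrt₂ (Ioi 0) :=
  (contDiffOn_g.comp (contDiffOn_id.sqrt fun _ h => ne_of_gt h)
    fun _ h => Real.sqrt_pos.2 h).div_const 4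

theorem hasDerivAt_logCoshSqrt₂ {s : ℝ} (hs : 0 < s) :
    HasDerivAt logCoshSqrt₂ (deriv logCoshSqrt₂ s) s :=
  ((contDiffOn_logCoshSqrt₂ (n := 1)).differentiableOn one_ne_zero |>.differentiableAt
    (Ioi_mem_nhds hs)).hasDerivAt

theorem continuousOn_logCoshSqrt : ContinuousOn logCoshSqrt (Ioi 0) :=
  fun _ hs => (hasDerivAt_logCoshSqrt hs).continuousAt.continuousWithinAt

theorem continuousOn_logCoshSqrt₁ : ContinuousOn logCoshSqrt₁ (Ioi 0) :=
  fun _ hs => (hasDerivAt_logCoshSqrt₁ hs).continuousAt.continuousWithinAt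

theorem continuousOn_logCoshSqrt₂ : ContinuousOn logCoshSqrt₂ (Ioi 0) :=
  fun _ hs => (hasDerivAt_logCoshSqrt₂ hs).continuousAt.continuousWithinAt

theorem continuousOn_deriv_logCoshSqrt₂ : ContinuousOn (deriv logCoshSqrt₂) (Ioi 0) :=
  (contDiffOn_logCoshSqrt₂ (n := 1)).continuousOn_deriv_of_isOpen isOpen_Ioi le_rfl

/-! ### The condensation energy of a single mode -/

/-- `condensation t a b = 4 t (A(a') - A(b') + (b' - a') A'(b'))` with `A = logCoshSqrt`,
`a' = a / (4 t²)`, `b' = b / (4 t²)`. For `a = x²` and `b = x² + u²` this is, up to the factor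
`N 0`, the integrand of `Ψ` at temperature `t`: a Bregman divergence of `A`, so that it vanishes to
second order at `b = a`. -/
noncomputable def condensation (t a b : ℝ) : ℝ :=
  4 * t * (logCoshSqrt (a / (4 * t ^ 2)) - logCoshSqrt (b / (4 * t ^ 2)) +
    (b - a) / (4 * t ^ 2) * logCoshSqrt₁ (b / (4 * t ^ 2)))

/-- The derivative of `condensation t a (b t)` in `t`, where `b₁` stands for `b' t`. -/
noncomputable def condensation₁ (t a b b₁ : ℝ) : ℝ :=
  4 * (logCoshSqrt (a / (4 * t ^ 2)) - logCoshSqrt (b / (4 * t ^ 2)) +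
      (b - a) / (4 * t ^ 2) * logCoshSqrt₁ (b / (4 * t ^ 2))) +
    4 * t * (-(a / (2 * t ^ 3)) *
        (logCoshSqrt₁ (a / (4 * t ^ 2)) - logCoshSqrt₁ (b / (4 * t ^ 2))) +
      (b - a) / (4 * t ^ 2) * logCoshSqrt₂ (b / (4 * t ^ 2)) *
        (b₁ / (4 * t ^ 2) - b / (2 * t ^ 3)))

/-- The second derivative of `condensation t a (b t)` in `t`, where `b₁`, `b₂` stand for `b' t`,
`b'' t`. -/
noncomputable def condensation₂ (t a b b₁ b₂ : ℝ) : ℝ :=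
  8 * (-(a / (2 * t ^ 3)) *
        (logCoshSqrt₁ (a / (4 * t ^ 2)) - logCoshSqrt₁ (b / (4 * t ^ 2))) +
      (b - a) / (4 * t ^ 2) * logCoshSqrt₂ (b / (4 * t ^ 2)) *
        (b₁ / (4 * t ^ 2) - b / (2 * t ^ 3))) +
    4 * t * (3 * a / (2 * t ^ 4) *
        (logCoshSqrt₁ (a / (4 * t ^ 2)) - logCoshSqrt₁ (b / (4 * t ^ 2))) +
      -(a / (2 * t ^ 3)) * (logCoshSqrt₂ (a / (4 * t ^ 2)) * -(a / (2 * t ^ 3)) -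
        logCoshSqrt₂ (b / (4 * t ^ 2)) * (b₁ / (4 * t ^ 2) - b / (2 * t ^ 3))) +
      ((b₁ / (4 * t ^ 2) - (b - a) / (2 * t ^ 3)) * logCoshSqrt₂ (b / (4 * t ^ 2)) +
          (b - a) / (4 * t ^ 2) * (deriv logCoshSqrt₂ (b / (4 * t ^ 2)) *
            (b₁ / (4 * t ^ 2) - b / (2 * t ^ 3)))) *
        (b₁ / (4 * t ^ 2) - b / (2 * t ^ 3)) +
      (b - a) / (4 * t ^ 2) * logCoshSqrt₂ (b / (4 * t ^ 2)) *
        (b₂ / (4 * t ^ 2) - b₁ / t ^ 3 + 3 * b / (2 * t ^ 4)))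

theorem hasDerivAt_div_sq {b : ℝ → ℝ} {b₁ t : ℝ} (ht : 0 < t) (hb : HasDerivAt b b₁ t) :
    HasDerivAt (fun t => b t / (4 * t ^ 2)) (b₁ / (4 * t ^ 2) - b t / (2 * t ^ 3)) t := by
  refine (hb.div ((hasDerivAt_pow 2 t).const_mul 4) (by positivity)).congr_deriv ?_
  field_simp
  ring

theorem hasDerivAt_div_cube {b : ℝ → ℝ} {b₁ t : ℝ} (ht : 0 < t) (hb : HasDerivAt b b₁ t) :
    HasDerivAt (fun t => b t / (2 * t ^ 3)) (b₁ / (2 * t ^ 3) - 3 * b t / (2 * t ^ 4)) t := by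
  refine (hb.div ((hasDerivAt_pow 3 t).const_mul 2) (by positivity)).congr_deriv ?_
  field_simp
  ring

theorem hasDerivAt_condensation {b : ℝ → ℝ} {a b₁ t : ℝ} (ht : 0 < t) (ha : 0 < a) (h : 0 < b t)
    (hb : HasDerivAt b b₁ t) :
    HasDerivAt (fun t => condensation t a (b t)) (condensation₁ t a (b t) b₁) t := by
  have hsa := hasDerivAt_div_sq ht (hasDerivAt_const t a)
  have hsb := hasDerivAt_div_sq ht hb
  have hd := hasDerivAt_div_sq ht (hb.sub_const a)
  have pa : 0 < a / (4 * t ^ 2) := by positivity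
  have pb : 0 < b t / (4 * t ^ 2) := by positivity
  have ka := (hasDerivAt_logCoshSqrt pa).comp t hsa
  have kb := (hasDerivAt_logCoshSqrt pb).comp t hsb
  have kb₁ := (hasDerivAt_logCoshSqrt₁ pb).comp t hsb
  refine (((hasDerivAt_id t).const_mul 4).mul ((ka.sub kb).add (hd.mul kb₁))).congr_deriv ?_
  simp only [condensation₁, Function.comp, id, Pi.sub_apply, Pi.mul_apply, Pi.add_apply]
  ring

theorem hasDerivAt_condensation₁ {b c : ℝ → ℝ} {a c₁ t : ℝ} (ht : 0 < t) (ha : 0 < a)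
    (h : 0 < b t) (hb : HasDerivAt b (c t) t) (hc : HasDerivAt c c₁ t) :
    HasDerivAt (fun t => condensation₁ t a (b t) (c t)) (condensation₂ t a (b t) (c t) c₁) t := by
  have hsa := hasDerivAt_div_sq ht (hasDerivAt_const t a)
  have hsb := hasDerivAt_div_sq ht hb
  have hd := hasDerivAt_div_sq ht (hb.sub_const a)
  have hsa₁ := (hasDerivAt_div_cube ht (hasDerivAt_const t a)).neg
  have hsb₁ := (hasDerivAt_div_sq ht hc).sub (hasDerivAt_div_cube ht hb)
  have pa : 0 < a / (4 * t ^ 2) := by positivity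
  have pb : 0 < b t / (4 * t ^ 2) := by positivity
  have ka := (hasDerivAt_logCoshSqrt pa).comp t hsa
  have kb := (hasDerivAt_logCoshSqrt pb).comp t hsb
  have ka₁ := (hasDerivAt_logCoshSqrt₁ pa).comp t hsa
  have kb₁ := (hasDerivAt_logCoshSqrt₁ pb).comp t hsb
  have kb₂ := (hasDerivAt_logCoshSqrt₂ pb).comp t hsb
  refine ((((ka.sub kb).add (hd.mul kb₁)).const_mul 4).add
    (((hasDerivAt_id t).const_mul 4).mul ((hsa₁.mul (ka₁.sub kb₁)).add
      ((hd.mul kb₂).mul hsb₁)))).congr_deriv ?_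
  simp only [condensation₂, Function.comp, id, Pi.neg_apply, Pi.sub_apply, Pi.mul_apply,
    Pi.add_apply]
  ring

theorem condensation_self (t a : ℝ) : condensation t a a = 0 := by simp [condensation]

theorem condensation₁_self (t a b₁ : ℝ) : condensation₁ t a a b₁ = 0 := by simp [condensation₁]

/-- Only the curvature `A''` survives at vanishing gap. -/
theorem condensation₂_self {t x : ℝ} (ht : 0 < t) (hx : 0 < x) (b₁ b₂ : ℝ) :
    condensation₂ t (x ^ 2) (x ^ 2) b₁ b₂ = b₁ ^ 2 * g (x / (2 * t)) / (16 * t ^ 3) := by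
  have h : √(x ^ 2 / (4 * t ^ 2)) = x / (2 * t) := by
    rw [show x ^ 2 / (4 * t ^ 2) = (x / (2 * t)) ^ 2 by ring, Real.sqrt_sq (by positivity)]
  simp only [condensation₂, logCoshSqrt₂, h, sub_self]
  field_simp
  ring

section Continuity

variable {X : Type*} [TopologicalSpace X] {D : Set X} {t a b b₁ b₂ : X → ℝ}

theorem continuousOn_condensation (ht : ContinuousOn t D) (ha : ContinuousOn a D)
    (hb : ContinuousOn b D) (pt : ∀ p ∈ D, 0 < t p) (pa : ∀ p ∈ D, 0 < a p)
    (pb : ∀ p ∈ D, 0 < b p) : ContinuousOn (fun p => condensation (t p) (a p) (b p)) D := by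
  have h2 : ∀ p ∈ D, 4 * t p ^ 2 ≠ 0 := fun p hp => by have := pt p hp; positivity
  have hsa := ha.div (continuousOn_const.mul (ht.pow 2)) h2
  have hsb := hb.div (continuousOn_const.mul (ht.pow 2)) h2
  have hd := (hb.sub ha).div (continuousOn_const.mul (ht.pow 2)) h2
  have qa : MapsTo (fun p => a p / (4 * t p ^ 2)) D (Ioi 0) := fun p hp => by
    have := pt p hp; have := pa p hp; simp only [mem_Ioi]; positivity
  have qb : MapsTo (fun p => b p / (4 * t p ^ 2)) D (Ioi 0) := fun p hp => by
    have := pt p hp; have := pb p hp; simp only [mem_Ioi]; positivity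
  have ka := continuousOn_logCoshSqrt.comp hsa qa
  have kb := continuousOn_logCoshSqrt.comp hsb qb
  have kb₁ := continuousOn_logCoshSqrt₁.comp hsb qb
  exact (continuousOn_const.mul ht).mul ((ka.sub kb).add (hd.mul kb₁))

theorem continuousOn_condensation₁ (ht : ContinuousOn t D) (ha : ContinuousOn a D)
    (hb : ContinuousOn b D) (hb₁ : ContinuousOn b₁ D) (pt : ∀ p ∈ D, 0 < t p)
    (pa : ∀ p ∈ D, 0 < a p) (pb : ∀ p ∈ D, 0 < b p) :
    ContinuousOn (fun p => condensation₁ (t p) (a p) (b p) (b₁ p)) D := by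
  have h2 : ∀ p ∈ D, 4 * t p ^ 2 ≠ 0 := fun p hp => by have := pt p hp; positivity
  have h3 : ∀ p ∈ D, 2 * t p ^ 3 ≠ 0 := fun p hp => by have := pt p hp; positivity
  have hsa := ha.div (continuousOn_const.mul (ht.pow 2)) h2
  have hsb := hb.div (continuousOn_const.mul (ht.pow 2)) h2
  have hd := (hb.sub ha).div (continuousOn_const.mul (ht.pow 2)) h2
  have hsa₁ := (ha.div (continuousOn_const.mul (ht.pow 3)) h3).neg
  have hsb₁ := (hb₁.div (continuousOn_const.mul (ht.pow 2)) h2).sub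
    (hb.div (continuousOn_const.mul (ht.pow 3)) h3)
  have qa : MapsTo (fun p => a p / (4 * t p ^ 2)) D (Ioi 0) := fun p hp => by
    have := pt p hp; have := pa p hp; simp only [mem_Ioi]; positivity
  have qb : MapsTo (fun p => b p / (4 * t p ^ 2)) D (Ioi 0) := fun p hp => by
    have := pt p hp; have := pb p hp; simp only [mem_Ioi]; positivity
  have ka := continuousOn_logCoshSqrt.comp hsa qa
  have kb := continuousOn_logCoshSqrt.comp hsb qb
  have ka₁ := continuousOn_logCoshSqrt₁.comp hsa qa
  have kb₁ := continuousOn_logCoshSqrt₁.comp hsb qb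
  have kb₂ := continuousOn_logCoshSqrt₂.comp hsb qb
  exact (continuousOn_const.mul ((ka.sub kb).add (hd.mul kb₁))).add
    ((continuousOn_const.mul ht).mul ((hsa₁.mul (ka₁.sub kb₁)).add ((hd.mul kb₂).mul hsb₁)))

theorem continuousOn_condensation₂ (ht : ContinuousOn t D) (ha : ContinuousOn a D)
    (hb : ContinuousOn b D) (hb₁ : ContinuousOn b₁ D) (hb₂ : ContinuousOn b₂ D)
    (pt : ∀ p ∈ D, 0 < t p) (pa : ∀ p ∈ D, 0 < a p) (pb : ∀ p ∈ D, 0 < b p) :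
    ContinuousOn (fun p => condensation₂ (t p) (a p) (b p) (b₁ p) (b₂ p)) D := by
  have h2 : ∀ p ∈ D, 4 * t p ^ 2 ≠ 0 := fun p hp => by have := pt p hp; positivity
  have h3 : ∀ p ∈ D, 2 * t p ^ 3 ≠ 0 := fun p hp => by have := pt p hp; positivity
  have h3' : ∀ p ∈ D, t p ^ 3 ≠ 0 := fun p hp => by have := pt p hp; positivity
  have h4 : ∀ p ∈ D, 2 * t p ^ 4 ≠ 0 := fun p hp => by have := pt p hp; positivity
  have c2 := continuousOn_const (c := (4 : ℝ)).mul (ht.pow 2)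
  have c3 := continuousOn_const (c := (2 : ℝ)).mul (ht.pow 3)
  have c4 := continuousOn_const (c := (2 : ℝ)).mul (ht.pow 4)
  have hsa := ha.div c2 h2
  have hsb := hb.div c2 h2
  have hd := (hb.sub ha).div c2 h2
  have hsa₁ := (ha.div c3 h3).neg
  have hsb₁ := (hb₁.div c2 h2).sub (hb.div c3 h3)
  have hd₁ := (hb₁.div c2 h2).sub ((hb.sub ha).div c3 h3)
  have hsa₂ := (continuousOn_const (c := (3 : ℝ)).mul ha).div c4 h4
  have hsb₂ := ((hb₂.div c2 h2).sub (hb₁.div (ht.pow 3) h3')).add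
    ((continuousOn_const (c := (3 : ℝ)).mul hb).div c4 h4)
  have qa : MapsTo (fun p => a p / (4 * t p ^ 2)) D (Ioi 0) := fun p hp => by
    have := pt p hp; have := pa p hp; simp only [mem_Ioi]; positivity
  have qb : MapsTo (fun p => b p / (4 * t p ^ 2)) D (Ioi 0) := fun p hp => by
    have := pt p hp; have := pb p hp; simp only [mem_Ioi]; positivity
  have ka₁ := continuousOn_logCoshSqrt₁.comp hsa qa
  have kb₁ := continuousOn_logCoshSqrt₁.comp hsb qb
  have ka₂ := continuousOn_logCoshSqrt₂.comp hsa qa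
  have kb₂ := continuousOn_logCoshSqrt₂.comp hsb qb
  have kb₃ := continuousOn_deriv_logCoshSqrt₂.comp hsb qb
  exact (continuousOn_const.mul ((hsa₁.mul (ka₁.sub kb₁)).add ((hd.mul kb₂).mul hsb₁))).add
    ((continuousOn_const.mul ht).mul ((((hsa₂.mul (ka₁.sub kb₁)).add
      (hsa₁.mul ((ka₂.mul hsa₁).sub (kb₂.mul hsb₁)))).add
      (((hd₁.mul kb₂).add (hd.mul (kb₃.mul hsb₁))).mul hsb₁)).add ((hd.mul kb₂).mul hsb₂)))

end Continuity

/-- The integrand of `Ψ` in terms of `condensation`; it uses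
`2 E + 4 T log (1 + exp (-E / T)) = 4 T log (2 cosh (E / (2 T)))`. -/
theorem condensation_eq {T x y : ℝ} (hT : 0 < T) (hx : 0 < x) :
    condensation T (x ^ 2) (x ^ 2 + y ^ 2) =
      -2 * (√(x ^ 2 + y ^ 2) - x) +
        y ^ 2 / √(x ^ 2 + y ^ 2) * Real.tanh (√(x ^ 2 + y ^ 2) / (2 * T)) -
        4 * T * Real.log ((1 + Real.exp (-√(x ^ 2 + y ^ 2) / T)) / (1 + Real.exp (-x / T))) := by
  have hE : 0 < √(x ^ 2 + y ^ 2) := Real.sqrt_pos.2 (by positivity)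
  have hE2 : x ^ 2 + y ^ 2 = √(x ^ 2 + y ^ 2) ^ 2 := (Real.sq_sqrt (by positivity)).symm
  set E := √(x ^ 2 + y ^ 2)
  have key : ∀ z : ℝ, 0 < z → √(z ^ 2 / (4 * T ^ 2)) = z / (2 * T) := fun z hz => by
    rw [show z ^ 2 / (4 * T ^ 2) = (z / (2 * T)) ^ 2 by ring, Real.sqrt_sq (by positivity)]
  have hlog : ∀ z : ℝ, Real.log (1 + Real.exp (-z / T)) =
      Real.log (Real.cosh (z / (2 * T))) + Real.log 2 - z / (2 * T) := fun z => by
    have h1 : 1 + Real.exp (-z / T) =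
        Real.cosh (z / (2 * T)) * 2 * Real.exp (-(z / (2 * T))) := by
      have e1 : Real.exp (-z / T) = Real.exp (-(z / (2 * T))) * Real.exp (-(z / (2 * T))) := by
        rw [← Real.exp_add]; congr 1; field_simp; ring
      have e2 : Real.exp (z / (2 * T)) * Real.exp (-(z / (2 * T))) = 1 := by
        rw [← Real.exp_add, add_neg_cancel, Real.exp_zero]
      rw [Real.cosh_eq, e1]
      linear_combination -e2
    have hc := Real.cosh_pos (z / (2 * T))
    rw [h1, Real.log_mul (by positivity) (by positivity), Real.log_mul hc.ne' two_ne_zero,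
      Real.log_exp]
    ring
  rw [Real.log_div (by positivity) (by positivity), hlog, hlog]
  simp only [condensation, logCoshSqrt, logCoshSqrt₁, hE2, key _ hx, key _ hE]
  rw [show y ^ 2 = E ^ 2 - x ^ 2 by linarith]
  field_simp
  ring

/-! ### The normal state -/

theorem contDiffOn_two_of_hasDerivAt {f f₁ f₂ : ℝ → ℝ} {S : Set ℝ} (hS : IsOpen S)
    (h : ∀ t ∈ S, HasDerivAt f (f₁ t) t) (h₁ : ∀ t ∈ S, HasDerivAt f₁ (f₂ t) t)
    (h₂ : ContinuousOn f₂ S) : ContDiffOn ℝ 2 f S := by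
  have c₁ : ContDiffOn ℝ 1 f₁ S := by
    rw [show (1 : WithTop ℕ∞) = 0 + 1 by simp, contDiffOn_succ_iff_deriv_of_isOpen hS]
    exact ⟨fun t ht => (h₁ t ht).differentiableAt.differentiableWithinAt, by simp,
      contDiffOn_zero.2 (h₂.congr fun t ht => (h₁ t ht).deriv)⟩
  rw [show (2 : WithTop ℕ∞) = 1 + 1 by norm_num, contDiffOn_succ_iff_deriv_of_isOpen hS]
  exact ⟨fun t ht => (h t ht).differentiableAt.differentiableWithinAt, by simp,
    c₁.congr fun t ht => (h t ht).deriv⟩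

theorem hasDerivAt_log_one_add_exp (y β : ℝ) :
    HasDerivAt (fun β => Real.log (1 + Real.exp (-(β * y)))) (-y / (1 + Real.exp (β * y))) β := by
  have h := ((((hasDerivAt_id β).mul_const y).neg.exp).const_add 1).log
    (show (1 + Real.exp (-(id β * y))) ≠ 0 by positivity)
  refine h.congr_deriv ?_
  simp only [id, Pi.neg_apply, Real.exp_neg]
  have := Real.exp_pos (β * y)
  field_simp
  ring

theorem hasDerivAt_div_one_add_exp (y β : ℝ) :
    HasDerivAt (fun β => -y / (1 + Real.exp (β * y)))
      (y ^ 2 * Real.exp (β * y) / (1 + Real.exp (β * y)) ^ 2) β := by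
  have h := (hasDerivAt_const β (-y)).div ((((hasDerivAt_id β).mul_const y).exp).const_add 1)
    (show (1 + Real.exp (id β * y)) ≠ 0 by positivity)
  refine h.congr_deriv ?_
  simp only [id]
  ring

/-- Twofold differentiation under the integral sign in the inverse temperature `β`, dominated by
`|n| y ^ k exp (-b y)` for `β > b`. -/
theorem contDiffOn_integral_log_one_add_exp {α : Type*} [MeasurableSpace α] {ν : Measure α}
    {n y : α → ℝ} (hy : ∀ᵐ x ∂ν, 0 ≤ y x) (hn : AEStronglyMeasurable n ν)
    (hym : AEStronglyMeasurable y ν)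
    (hint : ∀ b > 0, ∀ k : ℕ, Integrable (fun x => n x * (y x ^ k * Real.exp (-b * y x))) ν) :
    ContDiffOn ℝ 2 (fun β => ∫ x, n x * Real.log (1 + Real.exp (-(β * y x))) ∂ν) (Ioi 0) := by
  have m₀ : ∀ β, AEStronglyMeasurable
      (fun x => n x * Real.log (1 + Real.exp (-(β * y x)))) ν := fun β =>
    hn.mul ((Continuous.log (f := fun z => 1 + Real.exp (-(β * z))) (by fun_prop)
      fun z => by positivity).comp_aestronglyMeasurable hym)
  have m₁ : ∀ β, AEStronglyMeasurable
      (fun x => n x * (-y x / (1 + Real.exp (β * y x)))) ν := fun β =>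
    hn.mul ((Continuous.div (f := fun z => -z) (g := fun z => 1 + Real.exp (β * z)) (by fun_prop)
      (by fun_prop) fun z => by positivity).comp_aestronglyMeasurable hym)
  have m₂ : ∀ β, AEStronglyMeasurable
      (fun x => n x * (y x ^ 2 * Real.exp (β * y x) / (1 + Real.exp (β * y x)) ^ 2)) ν := fun β =>
    hn.mul ((Continuous.div (f := fun z => z ^ 2 * Real.exp (β * z))
      (g := fun z => (1 + Real.exp (β * z)) ^ 2) (by fun_prop)
      (by fun_prop) fun z => by positivity).comp_aestronglyMeasurable hym)
  have mono : ∀ {b β z : ℝ}, b < β → 0 ≤ z → Real.exp (-(β * z)) ≤ Real.exp (-b * z) :=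
    fun hb hz => Real.exp_le_exp.2 (by nlinarith)
  have b₀ : ∀ {b β z : ℝ}, b < β → 0 ≤ z →
      |Real.log (1 + Real.exp (-(β * z)))| ≤ z ^ 0 * Real.exp (-b * z) := by
    intro b β z hb hz
    have hp := Real.exp_pos (-(β * z))
    rw [abs_of_nonneg (Real.log_nonneg (by linarith)), pow_zero, one_mul]
    refine le_trans ?_ (mono hb hz)
    linarith [Real.log_le_sub_one_of_pos (show 0 < 1 + Real.exp (-(β * z)) by positivity)]
  have b₁ : ∀ {b β z : ℝ}, b < β → 0 ≤ z →
      |-z / (1 + Real.exp (β * z))| ≤ z ^ 1 * Real.exp (-b * z) := by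
    intro b β z hb hz
    have hp := Real.exp_pos (β * z)
    rw [abs_div, abs_neg, abs_of_nonneg hz, abs_of_pos (by positivity), pow_one, div_eq_mul_inv]
    refine mul_le_mul_of_nonneg_left (le_trans ?_ (mono hb hz)) hz
    rw [Real.exp_neg]
    exact inv_anti₀ hp (by linarith)
  have b₂ : ∀ {b β z : ℝ}, b < β → 0 ≤ z →
      |z ^ 2 * Real.exp (β * z) / (1 + Real.exp (β * z)) ^ 2| ≤ z ^ 2 * Real.exp (-b * z) := by
    intro b β z hb hz
    have hp := Real.exp_pos (β * z)
    rw [abs_of_nonneg (by positivity), mul_div_assoc]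
    refine mul_le_mul_of_nonneg_left (le_trans ?_ (mono hb hz)) (by positivity)
    rw [Real.exp_neg, div_le_iff₀ (by positivity), inv_mul_eq_div, le_div_iff₀ hp]
    nlinarith
  have hnorm : ∀ {c q r : ℝ}, |q| ≤ r → ‖c * q‖ ≤ ‖c * r‖ := fun {c q r} h => by
    rw [norm_mul, norm_mul, Real.norm_eq_abs q, Real.norm_eq_abs r]
    exact mul_le_mul_of_nonneg_left (h.trans (le_abs_self r)) (norm_nonneg c)
  have i₀ : ∀ β > 0, Integrable (fun x => n x * Real.log (1 + Real.exp (-(β * y x)))) ν :=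
    fun β hβ => (hint (β / 2) (half_pos hβ) 0).mono (m₀ β)
      (hy.mono fun x hx => hnorm (b₀ (half_lt_self hβ) hx))
  have i₁ : ∀ β > 0, Integrable (fun x => n x * (-y x / (1 + Real.exp (β * y x)))) ν :=
    fun β hβ => (hint (β / 2) (half_pos hβ) 1).mono (m₁ β)
      (hy.mono fun x hx => hnorm (b₁ (half_lt_self hβ) hx))
  refine contDiffOn_two_of_hasDerivAt isOpen_Ioi
    (f₁ := fun β => ∫ x, n x * (-y x / (1 + Real.exp (β * y x))) ∂ν)
    (f₂ := fun β => ∫ x, n x *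
      (y x ^ 2 * Real.exp (β * y x) / (1 + Real.exp (β * y x)) ^ 2) ∂ν) ?_ ?_ ?_
  · intro β hβ
    refine (hasDerivAt_integral_of_dominated_loc_of_deriv_le
      (bound := fun x => ‖n x * (y x ^ 1 * Real.exp (-(β / 2) * y x))‖)
      (Ioi_mem_nhds (half_lt_self hβ)) (.of_forall m₀) (i₀ β hβ) (m₁ β)
      (hy.mono fun x hx t ht => hnorm (b₁ (mem_Ioi.1 ht) hx)) (hint _ (half_pos hβ) 1).norm ?_).2
    exact .of_forall fun x t _ => (hasDerivAt_log_one_add_exp (y x) t).const_mul (n x)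
  · intro β hβ
    refine (hasDerivAt_integral_of_dominated_loc_of_deriv_le
      (bound := fun x => ‖n x * (y x ^ 2 * Real.exp (-(β / 2) * y x))‖)
      (Ioi_mem_nhds (half_lt_self hβ)) (.of_forall m₁) (i₁ β hβ) (m₂ β)
      (hy.mono fun x hx t ht => hnorm (b₂ (mem_Ioi.1 ht) hx)) (hint _ (half_pos hβ) 2).norm ?_).2
    exact .of_forall fun x t _ => (hasDerivAt_div_one_add_exp (y x) t).const_mul (n x)
  · intro β hβ
    refine (continuousAt_of_dominated (.of_forall m₂) ?_
      (hint _ (half_pos hβ) 2).norm ?_).continuousWithinAt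
    · filter_upwards [Ioi_mem_nhds (half_lt_self hβ)] with t ht
      exact hy.mono fun x hx => hnorm (b₂ ht hx)
    · exact .of_forall fun x => (Continuous.mul continuous_const
        (Continuous.div (by fun_prop) (by fun_prop) fun z => by positivity)).continuousAt

theorem contDiffOn_setIntegral_log_one_add_exp {s : Set ℝ} (hs : MeasurableSet s) {n y : ℝ → ℝ}
    (hy : ∀ x ∈ s, 0 ≤ y x) (hn : ContinuousOn n s) (hyc : ContinuousOn y s)
    (hint : ∀ b > 0, ∀ k : ℕ,
      IntegrableOn (fun x => n x * (y x ^ k * Real.exp (-b * y x))) s) :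
    ContDiffOn ℝ 2 (fun T => ∫ x in s, n x * Real.log (1 + Real.exp (-y x / T))) (Ioi 0) := by
  have h := contDiffOn_integral_log_one_add_exp (ν := volume.restrict s)
    ((ae_restrict_iff' hs).2 (.of_forall hy)) (hn.aestronglyMeasurable hs)
    (hyc.aestronglyMeasurable hs) hint
  refine (h.comp (f := fun T : ℝ => T⁻¹) (contDiffOn_id.inv fun T hT => ne_of_gt hT)
    fun T hT => mem_Ioi.2 (inv_pos.2 hT)).congr fun T _ => ?_
  simp only [Function.comp]
  congr 1 with x
  rw [show -y x / T = -(T⁻¹ * y x) by ring]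

theorem contDiffOn_intervalIntegral_log_one_add_exp {a b : ℝ} (hab : a ≤ b) {n y : ℝ → ℝ}
    (hy : ∀ x ∈ Icc a b, 0 ≤ y x) (hn : ContinuousOn n (Icc a b))
    (hyc : ContinuousOn y (Icc a b)) :
    ContDiffOn ℝ 2 (fun T => ∫ x in a..b, n x * Real.log (1 + Real.exp (-y x / T))) (Ioi 0) := by
  simp only [intervalIntegral.integral_of_le hab]
  refine contDiffOn_setIntegral_log_one_add_exp measurableSet_Ioc
    (fun x hx => hy x (Ioc_subset_Icc_self hx)) (hn.mono Ioc_subset_Icc_self)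
    (hyc.mono Ioc_subset_Icc_self) fun c _ k => ?_
  refine IntegrableOn.mono_set (ContinuousOn.integrableOn_Icc ?_) Ioc_subset_Icc_self
  exact hn.mul ((hyc.pow k).mul (Real.continuous_exp.comp_continuousOn (continuousOn_const.mul hyc)))

theorem integrableOn_mul_pow_mul_exp {N : ℝ → ℝ} {a b : ℝ} (hN : ContinuousOn N (Ici a))
    (hO : N =O[atTop] Real.sqrt) (hb : 0 < b) (k : ℕ) :
    IntegrableOn (fun x => N x * (x ^ k * Real.exp (-b * x))) (Ioi a) := by
  refine integrable_of_isBigO_exp_neg (half_pos hb) (hN.mul (by fun_prop)) ?_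
  have h1 : Real.sqrt =O[atTop] fun x : ℝ => x := by
    refine Asymptotics.IsBigO.of_bound 1 ?_
    filter_upwards [eventually_ge_atTop 1] with x hx
    rw [one_mul, Real.norm_of_nonneg (Real.sqrt_nonneg x), Real.norm_of_nonneg (by linarith)]
    exact Real.sqrt_le_self_iff.2 (Or.inr hx)
  have h2 := (hO.trans h1).mul
    ((Asymptotics.isBigO_refl (fun x : ℝ => x ^ k * Real.exp (-b * x)) atTop))
  have h3 := ((isLittleO_pow_exp_pos_mul_atTop (k + 1) (half_pos hb)).isBigO).mul
    (Asymptotics.isBigO_refl (fun x : ℝ => Real.exp (-b * x)) atTop)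
  refine h2.trans ((h3.congr (fun x => by ring) fun x => ?_))
  rw [← Real.exp_add]
  congr 1
  ring

theorem contDiffOn_OmegaN {ε Λ μ : ℝ} {N : ℝ → ℝ} (hε : 0 < ε) (hεΛ : ε < Λ) (hΛμ : Λ < μ)
    (hN : ContinuousOn N (Ici (-μ))) (hO : N =O[atTop] Real.sqrt) :
    ContDiffOn ℝ 2 (OmegaN ε Λ μ N) (Ioi 0) := by
  have h₁ := contDiffOn_intervalIntegral_log_one_add_exp hεΛ.le (n := fun _ => 1) (y := fun x => x)
    (fun x hx => hε.le.trans hx.1) continuousOn_const continuousOn_id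
  have h₂ := contDiffOn_intervalIntegral_log_one_add_exp (neg_le_neg hΛμ.le) (n := N)
    (y := fun x => -x) (fun x hx => by linarith [hx.2]) (hN.mono fun x hx => hx.1)
    continuousOn_id.neg
  have hsub : Ici Λ ⊆ Ici (-μ) := Ici_subset_Ici.2 (by linarith)
  have h₃ := contDiffOn_setIntegral_log_one_add_exp (measurableSet_Ioi (a := Λ)) (n := N)
    (y := fun x => x) (fun x hx => (hε.trans (hεΛ.trans hx)).le)
    (hN.mono (Ioi_subset_Ici_self.trans hsub)) continuousOn_id
    fun b hb k => integrableOn_mul_pow_mul_exp (hN.mono hsub) hO hb k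
  simp only [one_mul, neg_neg] at h₁ h₂
  exact (contDiffOn_const.sub ((contDiffOn_const.mul contDiffOn_id).mul h₁)).add
    ((contDiffOn_const.sub ((contDiffOn_const.mul contDiffOn_id).mul h₂)).sub
      ((contDiffOn_const.mul contDiffOn_id).mul h₃))

/-! ### The squared gap and its temperature derivatives up to the transition temperature -/

/-- Partial derivatives in the first variable of a function that is `C^(n+1)` on a product `S × I`;
`S` is open, while `I` may have boundary points. -/
theorem contDiffOn_partialDeriv {F : ℝ → ℝ → ℝ} {S I : Set ℝ} {n : WithTop ℕ∞} (hS : IsOpen S)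
    (hI : UniqueDiffOn ℝ I) (hF : ContDiffOn ℝ (n + 1) (Function.uncurry F) (S ×ˢ I)) :
    (∀ T ∈ S, ∀ x ∈ I, HasDerivAt (fun t => F t x) (deriv (fun t => F t x) T) T) ∧
      ContDiffOn ℝ n (Function.uncurry fun T x => deriv (fun t => F t x) T) (S ×ˢ I) := by
  have hu : UniqueDiffOn ℝ (S ×ˢ I) := hS.uniqueDiffOn.prod hI
  have key : ∀ T ∈ S, ∀ x ∈ I, HasDerivAt (fun t => F t x)
      (fderivWithin ℝ (Function.uncurry F) (S ×ˢ I) (T, x) (1, 0)) T := by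
    intro T hT x hx
    have h := ((hF.differentiableOn (by simp)) (T, x) ⟨hT, hx⟩).hasFDerivWithinAt
    have hc : HasDerivWithinAt (fun t : ℝ => (t, x)) (1, 0) S T :=
      ((hasDerivAt_id T).prodMk (hasDerivAt_const T x)).hasDerivWithinAt
    have hm : MapsTo (fun t : ℝ => (t, x)) S (S ×ˢ I) := fun t ht => ⟨ht, hx⟩
    exact (h.comp_hasDerivWithinAt T hc hm).hasDerivAt (hS.mem_nhds hT)
  refine ⟨fun T hT x hx => (key T hT x hx).differentiableAt.hasDerivAt, ?_⟩
  exact ((hF.fderivWithin hu le_rfl).clm_apply contDiffOn_const).congr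
    fun p hp => (key p.1 hp.1 p.2 hp.2).deriv

/-- A continuous function on `(0, Tc) × I` that converges to `v` uniformly on `I` as `T ↑ Tc`
extends continuously to `(0, Tc] × I`. -/
theorem continuousOn_extend_of_uniform {h : ℝ → ℝ → ℝ} {v : ℝ → ℝ} {I : Set ℝ} {Tc : ℝ}
    (hh : ContinuousOn (Function.uncurry h) (Ioo 0 Tc ×ˢ I)) (hv : ContinuousOn v I)
    (hlim : ∀ r > 0, ∃ δ > 0, ∀ T ∈ Ioo 0 Tc, |Tc - T| < δ → ∀ x ∈ I, |v x - h T x| < r) :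
    ContinuousOn (Function.uncurry fun T x => if T < Tc then h T x else v x)
      (Ioc 0 Tc ×ˢ I) := by
  rintro ⟨T, x⟩ ⟨⟨hT0, hT⟩, hx⟩
  rcases lt_or_eq_of_le hT with hlt | rfl
  · have hev : ∀ᶠ p : ℝ × ℝ in 𝓝 (T, x), p.1 < Tc :=
      continuousAt_fst.eventually (gt_mem_nhds hlt)
    have h1 : ContinuousWithinAt (Function.uncurry h) (Ioc 0 Tc ×ˢ I) (T, x) := by
      refine (hh (T, x) ⟨⟨hT0, hlt⟩, hx⟩).mono_of_mem_nhdsWithin ?_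
      filter_upwards [self_mem_nhdsWithin, mem_nhdsWithin_of_mem_nhds hev] with p hp hp'
      exact ⟨⟨hp.1.1, hp'⟩, hp.2⟩
    refine h1.congr_of_eventuallyEq ?_ (by simp [Function.uncurry, hlt])
    filter_upwards [mem_nhdsWithin_of_mem_nhds hev] with p hp
    simp [Function.uncurry, hp]
  · have hvx : Tendsto (fun p : ℝ × ℝ => v p.2) (𝓝[Ioc 0 T ×ˢ I] (T, x)) (𝓝 (v x)) :=
      (hv x hx).comp (f := Prod.snd) (s := Ioc 0 T ×ˢ I) (x := (T, x))
        continuousWithinAt_snd fun p hp => hp.2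
    have hd : Tendsto (fun p : ℝ × ℝ => (if p.1 < T then h p.1 p.2 else v p.2) - v p.2)
        (𝓝[Ioc 0 T ×ˢ I] (T, x)) (𝓝 0) := by
      rw [Metric.tendsto_nhds]
      intro r hr
      obtain ⟨δ, hδ, H⟩ := hlim r hr
      have hev : ∀ᶠ p : ℝ × ℝ in 𝓝 (T, x), dist p.1 T < δ :=
        (continuousAt_fst (p := (T, x))).eventually (Metric.ball_mem_nhds T hδ)
      filter_upwards [self_mem_nhdsWithin, mem_nhdsWithin_of_mem_nhds hev] with p hp hp'
      rw [Real.dist_eq, sub_zero]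
      split_ifs with hlt
      · rw [abs_sub_comm]
        exact H p.1 ⟨hp.1.1, hlt⟩ (by rwa [abs_sub_comm, ← Real.dist_eq]) p.2 hp.2
      · simpa using hr
    have hsum := hd.add hvx
    simp only [sub_add_cancel, zero_add] at hsum
    have hval : Function.uncurry (fun t y => if t < T then h t y else v y) (T, x) = v x := by
      simp [Function.uncurry]
    rw [ContinuousWithinAt, hval]
    exact hsum

/-- The quotient `u² / (Tc - T)` stays bounded as `T ↑ Tc`, and `u` is continuous up to `Tc`. -/
theorem gap_eq_zero_at_transition {ε Λ Tc : ℝ} {u : ℝ → ℝ → ℝ} {v w : ℝ → ℝ} (hTc : 0 < Tc)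
    (hu : ContinuousOn (Function.uncurry u) (Icc 0 Tc ×ˢ Icc ε Λ))
    (hC : ConditionC ε Λ Tc u v w) {x : ℝ} (hx : x ∈ Icc ε Λ) : u Tc x = 0 := by
  have hle : 𝓝[<] Tc ≤ 𝓝[Icc 0 Tc] Tc := by
    rw [← nhdsWithin_Ioo_eq_nhdsLT hTc]
    exact nhdsWithin_mono _ Ioo_subset_Icc_self
  have h1 : Tendsto (fun T => u T x ^ 2) (𝓝[<] Tc) (𝓝 (u Tc x ^ 2)) := by
    have hc : ContinuousOn (fun T => u T x) (Icc 0 Tc) :=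
      hu.comp (f := fun T => (T, x)) (by fun_prop) fun T hT => ⟨hT, hx⟩
    exact ((hc Tc ⟨hTc.le, le_rfl⟩).mono_left hle).pow 2
  have h2 : Tendsto (fun T => u T x ^ 2) (𝓝[<] Tc) (𝓝 0) := by
    obtain ⟨δ, hδ, H⟩ := hC.2.2.2.1 1 one_pos
    have hb : Tendsto (fun T => (Tc - T) * (v x + Tc)) (𝓝[<] Tc) (𝓝 0) := by
      have : Continuous fun T => (Tc - T) * (v x + Tc) := by fun_prop
      have := (this.tendsto Tc).mono_left (nhdsWithin_le_nhds (s := Iio Tc))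
      simpa using this
    refine squeeze_zero' (.of_forall fun T => sq_nonneg _) ?_ hb
    filter_upwards [Ioo_mem_nhdsLT (max_lt hTc (sub_lt_self Tc hδ))] with T hT
    have hT' := max_lt_iff.1 hT.1
    have hpos : 0 < Tc - T := by linarith [hT.2]
    have h := (H T ⟨hT'.1, hT.2⟩ (by rw [abs_of_pos hpos]; linarith) x hx).1
    have h' := (abs_lt.1 h).1
    rw [mul_comm, ← div_le_iff₀ hpos]
    linarith
  exact pow_eq_zero_iff two_ne_zero |>.1 (tendsto_nhds_unique h1 h2)

/-- Condition (C) makes the squared gap `u²` a `C²` function of the temperature up to and including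
`Tc`, jointly continuously in `x`, with one-sided derivatives `-v` and `w` at `Tc`. -/
theorem exists_derivs_gap_sq {ε Λ Tc : ℝ} {u : ℝ → ℝ → ℝ} {v w : ℝ → ℝ} (hεΛ : ε < Λ)
    (hTc : 0 < Tc) (hu : ContDiffOn ℝ 2 (Function.uncurry u) (Ioo 0 Tc ×ˢ Icc ε Λ))
    (hC : ConditionC ε Λ Tc u v w) :
    ∃ f₁ f₂ : ℝ → ℝ → ℝ, ContinuousOn (Function.uncurry f₁) (Ioc 0 Tc ×ˢ Icc ε Λ) ∧
      ContinuousOn (Function.uncurry f₂) (Ioc 0 Tc ×ˢ Icc ε Λ) ∧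
      (∀ T ∈ Ioo 0 Tc, ∀ x ∈ Icc ε Λ, HasDerivAt (fun t => u t x ^ 2) (f₁ T x) T) ∧
      (∀ T ∈ Ioo 0 Tc, ∀ x ∈ Icc ε Λ, HasDerivAt (fun t => f₁ t x) (f₂ T x) T) ∧
      ∀ x ∈ Icc ε Λ, f₁ Tc x = -v x := by
  obtain ⟨hv, hw, -, h₁, h₂⟩ := hC
  have hI := uniqueDiffOn_Icc hεΛ
  obtain ⟨d₀, -⟩ := contDiffOn_partialDeriv (n := 1) isOpen_Ioo hI (by norm_num; exact hu)
  have hf : ContDiffOn ℝ (1 + 1) (Function.uncurry fun t x => u t x ^ 2) (Ioo 0 Tc ×ˢ Icc ε Λ) := by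
    norm_num
    exact hu.pow 2
  obtain ⟨d₁, c₁⟩ := contDiffOn_partialDeriv isOpen_Ioo hI hf
  obtain ⟨d₂, c₂⟩ := contDiffOn_partialDeriv (n := 0) isOpen_Ioo hI (by simpa using c₁)
  have e₁ : ∀ T ∈ Ioo 0 Tc, ∀ x ∈ Icc ε Λ,
      deriv (fun t => u t x ^ 2) T = 2 * u T x * deriv (fun t => u t x) T := fun T hT x hx => by
    have h : HasDerivAt (fun t => u t x ^ 2) _ T := (d₀ T hT x hx).pow 2
    simpa using h.deriv
  -- The derivatives below `Tc`, extended to `Tc` by their uniform limits `-v` and `w`.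
  refine ⟨fun T x => if T < Tc then deriv (fun t => u t x ^ 2) T else -v x,
    fun T x => if T < Tc then deriv (fun t => deriv (fun s => u s x ^ 2) t) T else w x,
    continuousOn_extend_of_uniform c₁.continuousOn hv.neg ?_,
    continuousOn_extend_of_uniform c₂.continuousOn hw ?_, ?_, ?_, ?_⟩
  · intro r hr
    -- The bound in condition (C) is `Tc * ε₁`.
    obtain ⟨δ, hδ, H⟩ := h₁ (r / Tc) (by positivity)
    refine ⟨δ, hδ, fun T hT hd x hx => ?_⟩
    have h := (H T hT hd x hx).2
    rw [mul_div_cancel₀ _ hTc.ne'] at h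
    rw [e₁ T hT x hx, ← abs_neg]
    convert h using 2
    change -(-v x - _) = _
    ring
  · intro r hr
    obtain ⟨δ, hδ, H⟩ := h₂ r hr
    exact ⟨δ, hδ, fun T hT hd x hx => (H T hT hd x hx).2⟩
  · intro T hT x hx
    simpa [hT.2] using d₁ T hT x hx
  · intro T hT x hx
    simp only [if_pos hT.2]
    refine (d₂ T hT x hx).congr_of_eventuallyEq ?_
    filter_upwards [Iio_mem_nhds hT.2] with t ht
    exact if_pos ht
  · intro x _
    simp

/-! ### The condensation energy `Ψ` near the transition temperature -/

theorem Psi_eq {ε Λ : ℝ} {N : ℝ → ℝ} {u : ℝ → ℝ → ℝ} {T : ℝ} (hε : 0 < ε) (hεΛ : ε < Λ)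
    (hT : 0 < T) (hu : ContinuousOn (u T) (Icc ε Λ)) :
    Psi ε Λ N u T = N 0 * ∫ x in ε..Λ, condensation T (x ^ 2) (x ^ 2 + u T x ^ 2) := by
  have hpos : ∀ x ∈ Icc ε Λ, 0 < x := fun x hx => hε.trans_le hx.1
  have hs : ContinuousOn (fun x => √(x ^ 2 + u T x ^ 2)) (Icc ε Λ) :=
    ((continuousOn_id.pow 2).add (hu.pow 2)).sqrt
  have hs0 : ∀ x ∈ Icc ε Λ, √(x ^ 2 + u T x ^ 2) ≠ 0 := fun x hx => by
    have := hpos x hx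
    exact (Real.sqrt_pos.2 (by positivity)).ne'
  have hI : ∀ {f : ℝ → ℝ}, ContinuousOn f (Icc ε Λ) → IntervalIntegrable f volume ε Λ :=
    fun hf => (hf.mono (uIcc_of_le hεΛ.le).subset).intervalIntegrable
  have i₁ : IntervalIntegrable (fun x => √(x ^ 2 + u T x ^ 2) - x) volume ε Λ := hI (hs.sub continuousOn_id)
  have i₂ : IntervalIntegrable (fun x => u T x ^ 2 / √(x ^ 2 + u T x ^ 2) *
      Real.tanh (√(x ^ 2 + u T x ^ 2) / (2 * T))) volume ε Λ := hI (((hu.pow 2).div hs hs0).mul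
    ((contDiff_tanh (n := 0)).continuous.comp_continuousOn (hs.div_const (2 * T))))
  have i₃ := hI (ContinuousOn.log (f := fun x => (1 + Real.exp (-√(x ^ 2 + u T x ^ 2) / T)) /
      (1 + Real.exp (-x / T)))
    ((continuousOn_const.add (Real.continuous_exp.comp_continuousOn (hs.neg.div_const T))).div
      (by fun_prop) fun x _ => by positivity) fun x _ => by positivity)
  have h : ∫ x in ε..Λ, condensation T (x ^ 2) (x ^ 2 + u T x ^ 2) =
      ∫ x in ε..Λ, (-2 * (√(x ^ 2 + u T x ^ 2) - x) +
        u T x ^ 2 / √(x ^ 2 + u T x ^ 2) * Real.tanh (√(x ^ 2 + u T x ^ 2) / (2 * T)) -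
        4 * T * Real.log ((1 + Real.exp (-√(x ^ 2 + u T x ^ 2) / T)) /
          (1 + Real.exp (-x / T)))) := by
    refine intervalIntegral.integral_congr fun x hx => ?_
    rw [uIcc_of_le hεΛ.le] at hx
    exact condensation_eq hT (hpos x hx)
  rw [h, intervalIntegral.integral_sub ((i₁.const_mul (-2)).add i₂) (i₃.const_mul (4 * T)),
    intervalIntegral.integral_add (i₁.const_mul (-2)) i₂, intervalIntegral.integral_const_mul,
    intervalIntegral.integral_const_mul, Psi]
  ring

/-- `Ψ` is `C²` up to `Tc` from the left, vanishes there together with its first derivative, and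
its second derivative at `Tc` is `-1 / Tc` times the gap of the specific heat. -/
theorem exists_derivs_Psi {ε Λ Tc : ℝ} {N : ℝ → ℝ} {u : ℝ → ℝ → ℝ} {v w : ℝ → ℝ} (hε : 0 < ε)
    (hεΛ : ε < Λ) (hTc : 0 < Tc)
    (hu : ContinuousOn (Function.uncurry u) (Icc 0 Tc ×ˢ Icc ε Λ))
    (hu₂ : ContDiffOn ℝ 2 (Function.uncurry u) (Ioo 0 Tc ×ˢ Icc ε Λ))
    (hC : ConditionC ε Λ Tc u v w) :
    ∃ Ψ₁ Ψ₂ : ℝ → ℝ, (∀ T ∈ Ioo 0 Tc, HasDerivAt (Psi ε Λ N u) (Ψ₁ T) T) ∧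
      (∀ T ∈ Ioo 0 Tc, HasDerivAt Ψ₁ (Ψ₂ T) T) ∧
      ContinuousOn (Psi ε Λ N u) (Ioc 0 Tc) ∧ ContinuousOn Ψ₁ (Ioc 0 Tc) ∧
      ContinuousOn Ψ₂ (Ioc 0 Tc) ∧ Psi ε Λ N u Tc = 0 ∧ Ψ₁ Tc = 0 ∧
      gapFormula ε Λ (N 0) Tc v = -Tc * Ψ₂ Tc := by
  obtain ⟨f₁, f₂, c₁, c₂, d₁, d₂, hf₁⟩ := exists_derivs_gap_sq hεΛ hTc hu₂ hC
  have hz : ∀ x ∈ Icc ε Λ, u Tc x = 0 := fun x hx => gap_eq_zero_at_transition hTc hu hC hx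
  have hpos : ∀ x ∈ Icc ε Λ, 0 < x := fun x hx => hε.trans_le hx.1
  have ct : ContinuousOn (fun p : ℝ × ℝ => p.1) (Ioc 0 Tc ×ˢ Icc ε Λ) := continuousOn_fst
  have ca : ContinuousOn (fun p : ℝ × ℝ => p.2 ^ 2) (Ioc 0 Tc ×ˢ Icc ε Λ) := continuousOn_snd.pow 2
  have cb : ContinuousOn (fun p : ℝ × ℝ => p.2 ^ 2 + u p.1 p.2 ^ 2) (Ioc 0 Tc ×ˢ Icc ε Λ) :=
    ca.add ((hu.mono (prod_mono Ioc_subset_Icc_self Subset.rfl)).pow 2)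
  have pt : ∀ p ∈ Ioc 0 Tc ×ˢ Icc ε Λ, 0 < p.1 := fun p hp => hp.1.1
  have pa : ∀ p ∈ Ioc 0 Tc ×ˢ Icc ε Λ, 0 < p.2 ^ 2 := fun p hp => pow_pos (hpos _ hp.2) 2
  have pb : ∀ p ∈ Ioc 0 Tc ×ˢ Icc ε Λ, 0 < p.2 ^ 2 + u p.1 p.2 ^ 2 := fun p hp => by
    have := hpos _ hp.2
    positivity
  have k₀ : ContinuousOn (Function.uncurry fun T x =>
      condensation T (x ^ 2) (x ^ 2 + u T x ^ 2)) (Ioc 0 Tc ×ˢ Icc ε Λ) :=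
    continuousOn_condensation ct ca cb pt pa pb
  have k₁ : ContinuousOn (Function.uncurry fun T x =>
      condensation₁ T (x ^ 2) (x ^ 2 + u T x ^ 2) (f₁ T x)) (Ioc 0 Tc ×ˢ Icc ε Λ) :=
    continuousOn_condensation₁ ct ca cb c₁ pt pa pb
  have k₂ : ContinuousOn (Function.uncurry fun T x =>
      condensation₂ T (x ^ 2) (x ^ 2 + u T x ^ 2) (f₁ T x) (f₂ T x)) (Ioc 0 Tc ×ˢ Icc ε Λ) :=
    continuousOn_condensation₂ ct ca cb c₁ c₂ pt pa pb
  have hsub : Ioo 0 Tc ×ˢ Icc ε Λ ⊆ Ioc 0 Tc ×ˢ Icc ε Λ :=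
    prod_mono Ioo_subset_Ioc_self Subset.rfl
  have hPsi : ∀ T ∈ Ioc 0 Tc, Psi ε Λ N u T =
      N 0 * ∫ x in ε..Λ, condensation T (x ^ 2) (x ^ 2 + u T x ^ 2) := fun T hT =>
    Psi_eq hε hεΛ hT.1 (continuousOn_slice hu (Ioc_subset_Icc_self hT))
  have hTc' : Tc ∈ Ioc 0 Tc := ⟨hTc, le_rfl⟩
  have hcongr : ∀ {F G : ℝ → ℝ}, (∀ x ∈ Icc ε Λ, F x = G x) →
      ∫ x in ε..Λ, F x = ∫ x in ε..Λ, G x := fun h =>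
    intervalIntegral.integral_congr fun x hx => h x (by rwa [uIcc_of_le hεΛ.le] at hx)
  refine ⟨fun T => N 0 * ∫ x in ε..Λ, condensation₁ T (x ^ 2) (x ^ 2 + u T x ^ 2) (f₁ T x),
    fun T => N 0 * ∫ x in ε..Λ, condensation₂ T (x ^ 2) (x ^ 2 + u T x ^ 2) (f₁ T x) (f₂ T x),
    ?_, ?_, ?_, ?_, ?_, ?_, ?_, ?_⟩
  · intro T hT
    refine ((hasDerivAt_intervalIntegral hεΛ.le isOpen_Ioo (k₀.mono hsub) (k₁.mono hsub)
      (fun t ht x hx => ?_) hT).const_mul (N 0)).congr_of_eventuallyEq ?_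
    · have := hpos x hx
      exact hasDerivAt_condensation (b := fun t => x ^ 2 + u t x ^ 2) ht.1 (by positivity)
        (by positivity) ((d₁ t ht x hx).const_add _)
    · filter_upwards [isOpen_Ioo.mem_nhds hT] with t ht using hPsi t (Ioo_subset_Ioc_self ht)
  · intro T hT
    refine (hasDerivAt_intervalIntegral hεΛ.le isOpen_Ioo (k₁.mono hsub) (k₂.mono hsub)
      (fun t ht x hx => ?_) hT).const_mul (N 0)
    have := hpos x hx
    exact hasDerivAt_condensation₁ (b := fun t => x ^ 2 + u t x ^ 2) (c := fun t => f₁ t x) ht.1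
      (by positivity) (by positivity) ((d₁ t ht x hx).const_add _) (d₂ t ht x hx)
  · exact (continuousOn_const.mul (continuousOn_intervalIntegral hεΛ.le k₀)).congr hPsi
  · exact continuousOn_const.mul (continuousOn_intervalIntegral hεΛ.le k₁)
  · exact continuousOn_const.mul (continuousOn_intervalIntegral hεΛ.le k₂)
  · rw [hPsi Tc hTc', hcongr (G := fun _ => 0) fun x hx => by simp [hz x hx, condensation_self]]
    simp
  · simp only
    rw [hcongr (G := fun _ => 0) fun x hx => by simp [hz x hx, condensation₁_self]]
    simp
  · simp only
    have hsubst := intervalIntegral.integral_comp_div (a := ε) (b := Λ) (c := 2 * Tc)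
      (fun η => v (2 * Tc * η) ^ 2 * g η) (by positivity)
    have h2 : 2 * Tc ≠ 0 := by positivity
    simp only [mul_div_cancel₀ _ h2, smul_eq_mul] at hsubst
    rw [hcongr (G := fun x => 1 / (16 * Tc ^ 3) * (v x ^ 2 * g (x / (2 * Tc)))) fun x hx => by
      rw [hz x hx, zero_pow two_ne_zero, add_zero, condensation₂_self hTc (hpos x hx), hf₁ x hx]
      ring, intervalIntegral.integral_const_mul, hsubst, gapFormula]
    field_simp
    ring

theorem gapFormula_pos {ε Λ N₀ Tc : ℝ} {v : ℝ → ℝ} (hε : 0 < ε) (hεΛ : ε < Λ) (hTc : 0 < Tc)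
    (hN₀ : 0 < N₀) (hvc : ContinuousOn v (Icc ε Λ)) (hv : ∀ x ∈ Icc ε Λ, 0 < v x) :
    0 < gapFormula ε Λ N₀ Tc v := by
  have h2 : 0 < 2 * Tc := by positivity
  have hlt : ε / (2 * Tc) < Λ / (2 * Tc) := div_lt_div_of_pos_right hεΛ h2
  have hmem : MapsTo (fun η => 2 * Tc * η) (Icc (ε / (2 * Tc)) (Λ / (2 * Tc))) (Icc ε Λ) :=
    fun η hη => ⟨(div_le_iff₀' h2).1 hη.1, (le_div_iff₀' h2).1 hη.2⟩
  have hpos : ∀ η ∈ Icc (ε / (2 * Tc)) (Λ / (2 * Tc)), 0 < η := fun η hη =>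
    (div_pos hε h2).trans_le hη.1
  have hint : IntervalIntegrable (fun η => -(v (2 * Tc * η) ^ 2 * g η)) volume
      (ε / (2 * Tc)) (Λ / (2 * Tc)) := by
    refine ContinuousOn.intervalIntegrable ?_
    rw [uIcc_of_le hlt.le]
    exact (((hvc.comp (by fun_prop) hmem).pow 2).mul
      ((contDiffOn_g (n := 0)).continuousOn.mono hpos)).neg
  have h := intervalIntegral.intervalIntegral_pos_of_pos_on hint (fun η hη => by
    have hη' := Ioo_subset_Icc_self hη
    have := hv _ (hmem hη')
    have := g_neg (hpos η hη')
    exact neg_pos.2 (mul_neg_of_pos_of_neg (by positivity) this)) hlt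
  rw [intervalIntegral.integral_neg] at h
  rw [gapFormula, neg_mul, ← mul_neg]
  positivity

/-! ### Gluing at the transition temperature -/

/-- Extension by `0` above `Tc`. -/
noncomputable def cutoff (Tc : ℝ) (p : ℝ → ℝ) (T : ℝ) : ℝ := if T ≤ Tc then p T else 0

section Cutoff

variable {Tc : ℝ} {p p' : ℝ → ℝ}

theorem cutoff_eventuallyEq_of_lt {T : ℝ} (hT : T < Tc) : cutoff Tc p =ᶠ[𝓝 T] p := by
  filter_upwards [Iio_mem_nhds hT] with t ht using if_pos (le_of_lt ht)

theorem cutoff_eventuallyEq_of_gt {T : ℝ} (hT : Tc < T) : cutoff Tc p =ᶠ[𝓝 T] fun _ => 0 := by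
  filter_upwards [Ioi_mem_nhds hT] with t ht using if_neg (not_le.2 ht)

theorem hasDerivAt_cutoff_of_ne (h : ∀ T ∈ Ioo 0 Tc, HasDerivAt p (p' T) T) {T : ℝ}
    (hT : T ∈ Ioi 0 \ {Tc}) : HasDerivAt (cutoff Tc p) (cutoff Tc p' T) T := by
  rcases lt_or_gt_of_ne hT.2 with hlt | hgt
  · rw [(cutoff_eventuallyEq_of_lt hlt).eq_of_nhds]
    exact (h T ⟨hT.1, hlt⟩).congr_of_eventuallyEq (cutoff_eventuallyEq_of_lt hlt)
  · rw [(cutoff_eventuallyEq_of_gt hgt).eq_of_nhds]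
    exact (hasDerivAt_const T 0).congr_of_eventuallyEq (cutoff_eventuallyEq_of_gt hgt)

theorem tendsto_cutoff_left (hTc : 0 < Tc) (h : ContinuousOn p (Ioc 0 Tc)) :
    Tendsto (cutoff Tc p) (𝓝[<] Tc) (𝓝 (p Tc)) := by
  have h1 : Tendsto p (𝓝[<] Tc) (𝓝 (p Tc)) := by
    refine (h Tc ⟨hTc, le_rfl⟩).mono_left ?_
    rw [← nhdsWithin_Ioo_eq_nhdsLT hTc]
    exact nhdsWithin_mono _ Ioo_subset_Ioc_self
  refine h1.congr' ?_
  filter_upwards [self_mem_nhdsWithin] with t ht using (if_pos (le_of_lt ht)).symm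

theorem tendsto_cutoff_right : Tendsto (cutoff Tc p) (𝓝[>] Tc) (𝓝 0) := by
  refine tendsto_const_nhds.congr' ?_
  filter_upwards [self_mem_nhdsWithin] with t ht using (if_neg (not_le.2 ht)).symm

theorem continuousOn_cutoff_of_ne (h : ContinuousOn p (Ioc 0 Tc)) :
    ContinuousOn (cutoff Tc p) (Ioi 0 \ {Tc}) := by
  intro T hT
  refine ContinuousAt.continuousWithinAt ?_
  rcases lt_or_gt_of_ne hT.2 with hlt | hgt
  · exact (h.continuousAt (Ioc_mem_nhds hT.1 hlt)).congr (cutoff_eventuallyEq_of_lt hlt).symm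
  · exact continuousAt_const.congr (cutoff_eventuallyEq_of_gt hgt).symm

theorem continuousAt_cutoff (hTc : 0 < Tc) (h : ContinuousOn p (Ioc 0 Tc)) (h0 : p Tc = 0) :
    ContinuousAt (cutoff Tc p) Tc := by
  rw [continuousAt_iff_continuous_left'_right']
  have : cutoff Tc p Tc = 0 := by simp [cutoff, h0]
  simp only [ContinuousWithinAt, this]
  exact ⟨h0 ▸ tendsto_cutoff_left hTc h, tendsto_cutoff_right⟩

theorem continuousOn_cutoff (hTc : 0 < Tc) (h : ContinuousOn p (Ioc 0 Tc)) (h0 : p Tc = 0) :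
    ContinuousOn (cutoff Tc p) (Ioi 0) := by
  intro T hT
  by_cases hne : T = Tc
  · exact hne ▸ (continuousAt_cutoff hTc h h0).continuousWithinAt
  · exact ((continuousOn_cutoff_of_ne h).continuousAt
      ((isOpen_Ioi.sdiff isClosed_singleton).mem_nhds ⟨hT, hne⟩)).continuousWithinAt

/-- At `Tc` the derivative is the limit of the derivatives on both sides. -/
theorem hasDerivAt_cutoff (hTc : 0 < Tc) (hp : ContinuousOn p (Ioc 0 Tc)) (h0 : p Tc = 0)
    (hp' : ContinuousOn p' (Ioc 0 Tc)) (h0' : p' Tc = 0)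
    (h : ∀ T ∈ Ioo 0 Tc, HasDerivAt p (p' T) T) {T : ℝ} (hT : T ∈ Ioi 0) :
    HasDerivAt (cutoff Tc p) (cutoff Tc p' T) T := by
  by_cases hne : T = Tc
  · subst hne
    have hd : cutoff T p' T = 0 := by simp [cutoff, h0']
    have hder : ∀ t ∈ Ioi 0 \ {T}, deriv (cutoff T p) t = cutoff T p' t := fun t ht =>
      (hasDerivAt_cutoff_of_ne h ht).deriv
    have hdiff : ∀ t ∈ Ioi 0 \ {T}, DifferentiableAt ℝ (cutoff T p) t := fun t ht =>
      (hasDerivAt_cutoff_of_ne h ht).differentiableAt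
    have hc := continuousAt_cutoff hTc hp h0
    rw [hd, ← hasDerivWithinAt_univ, ← Iic_union_Ici (a := T)]
    refine HasDerivWithinAt.union ?_ ?_
    · refine hasDerivWithinAt_Iic_of_tendsto_deriv (s := Ioo 0 T)
        (fun t ht => (hdiff t ⟨ht.1, ht.2.ne⟩).differentiableWithinAt) hc.continuousWithinAt
        (Ioo_mem_nhdsLT hTc) ((h0' ▸ tendsto_cutoff_left hTc hp').congr' ?_)
      filter_upwards [Ioo_mem_nhdsLT hTc] with t ht using (hder t ⟨ht.1, ht.2.ne⟩).symm
    · refine hasDerivWithinAt_Ici_of_tendsto_deriv (s := Ioi T)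
        (fun t ht => (hdiff t ⟨hTc.trans ht, ne_of_gt ht⟩).differentiableWithinAt)
        hc.continuousWithinAt self_mem_nhdsWithin ((tendsto_cutoff_right (p := p')).congr' ?_)
      filter_upwards [self_mem_nhdsWithin] with t ht using
        (hder t ⟨hTc.trans ht, ne_of_gt ht⟩).symm
  · exact hasDerivAt_cutoff_of_ne h ⟨hT, hne⟩

end Cutoff

/-- A `C²` function plus a correction below `Tc` that vanishes at `Tc` to first order but not to
second order: a second-order transition, with the gap of `-T ∂²/∂T²` coming from the second
derivative `p₂` of the correction. -/
theorem secondOrderTransition_of_cutoff {Ω n p p₁ p₂ : ℝ → ℝ} {Tc : ℝ} (hTc : 0 < Tc)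
    (hn : ContDiffOn ℝ 2 n (Ioi 0)) (hΩ : ∀ T, Ω T = n T + cutoff Tc p T)
    (h₁ : ∀ T ∈ Ioo 0 Tc, HasDerivAt p (p₁ T) T) (h₂ : ∀ T ∈ Ioo 0 Tc, HasDerivAt p₁ (p₂ T) T)
    (hc : ContinuousOn p (Ioc 0 Tc)) (hc₁ : ContinuousOn p₁ (Ioc 0 Tc))
    (hc₂ : ContinuousOn p₂ (Ioc 0 Tc)) (h0 : p Tc = 0) (h0₁ : p₁ Tc = 0) (h0₂ : p₂ Tc ≠ 0) :
    IsSecondOrderTransition Ω Tc ∧ HasSpecificHeatGap Ω Tc (-Tc * p₂ Tc) := by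
  obtain rfl : Ω = fun T => n T + cutoff Tc p T := funext hΩ
  have hn₁ : ContDiffOn ℝ 1 (deriv n) (Ioi 0) := hn.deriv_of_isOpen isOpen_Ioi (by norm_num)
  have hn₂ : ContinuousOn (deriv (deriv n)) (Ioi 0) :=
    hn₁.continuousOn_deriv_of_isOpen isOpen_Ioi le_rfl
  have dn : ∀ T ∈ Ioi (0 : ℝ), HasDerivAt n (deriv n T) T := fun T hT =>
    ((hn.differentiableOn two_ne_zero).differentiableAt (Ioi_mem_nhds hT)).hasDerivAt
  have dn₁ : ∀ T ∈ Ioi (0 : ℝ), HasDerivAt (deriv n) (deriv (deriv n) T) T := fun T hT =>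
    ((hn₁.differentiableOn one_ne_zero).differentiableAt (Ioi_mem_nhds hT)).hasDerivAt
  have hopen : IsOpen (Ioi 0 \ {Tc}) := isOpen_Ioi.sdiff isClosed_singleton
  have d₁ : ∀ T ∈ Ioi (0 : ℝ), HasDerivAt (fun T => n T + cutoff Tc p T)
      (deriv n T + cutoff Tc p₁ T) T := fun T hT =>
    (dn T hT).add (hasDerivAt_cutoff hTc hc h0 hc₁ h0₁ h₁ hT)
  have d₂ : ∀ T ∈ Ioi 0 \ {Tc}, HasDerivAt (fun T => deriv n T + cutoff Tc p₁ T)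
      (deriv (deriv n) T + cutoff Tc p₂ T) T := fun T hT =>
    (dn₁ T hT.1).add (hasDerivAt_cutoff_of_ne h₂ hT)
  have hdd : ∀ T ∈ Ioi 0 \ {Tc}, deriv (deriv fun T => n T + cutoff Tc p T) T =
      deriv (deriv n) T + cutoff Tc p₂ T := fun T hT => by
    refine ((d₂ T hT).congr_of_eventuallyEq ?_).deriv
    filter_upwards [Ioi_mem_nhds hT.1] with t ht using (d₁ t ht).deriv
  have hn₂c : Tendsto (deriv (deriv n)) (𝓝 Tc) (𝓝 (deriv (deriv n) Tc)) :=
    hn₂.continuousAt (Ioi_mem_nhds hTc)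
  have hleft : Tendsto (deriv (deriv fun T => n T + cutoff Tc p T)) (𝓝[<] Tc)
      (𝓝 (deriv (deriv n) Tc + p₂ Tc)) := by
    refine ((hn₂c.mono_left nhdsWithin_le_nhds).add (tendsto_cutoff_left hTc hc₂)).congr' ?_
    filter_upwards [Ioo_mem_nhdsLT hTc] with t ht using (hdd t ⟨ht.1, ht.2.ne⟩).symm
  have hright : Tendsto (deriv (deriv fun T => n T + cutoff Tc p T)) (𝓝[>] Tc)
      (𝓝 (deriv (deriv n) Tc + 0)) := by
    refine ((hn₂c.mono_left nhdsWithin_le_nhds).add (tendsto_cutoff_right (p := p₂))).congr' ?_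
    filter_upwards [self_mem_nhdsWithin] with t ht using
      (hdd t ⟨hTc.trans ht, ne_of_gt ht⟩).symm
  refine ⟨⟨?_, ?_, ?_⟩, ?_⟩
  · rw [show (1 : WithTop ℕ∞) = 0 + 1 by simp, contDiffOn_succ_iff_deriv_of_isOpen isOpen_Ioi]
    refine ⟨fun T hT => (d₁ T hT).differentiableAt.differentiableWithinAt, by simp,
      contDiffOn_zero.2 ?_⟩
    exact (hn₁.continuousOn.add (continuousOn_cutoff hTc hc₁ h0₁)).congr
      fun T hT => (d₁ T hT).deriv
  · exact contDiffOn_two_of_hasDerivAt hopen (fun T hT => d₁ T hT.1) d₂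
      ((hn₂.mono sdiff_subset).add (continuousOn_cutoff_of_ne hc₂))
  · rintro ⟨L, hL⟩
    have e₁ := tendsto_nhds_unique
      (hL.mono_left (nhdsWithin_mono Tc fun t (ht : t ∈ Iio Tc) => ne_of_lt ht)) hleft
    have e₂ := tendsto_nhds_unique
      (hL.mono_left (nhdsWithin_mono Tc fun t (ht : t ∈ Ioi Tc) => ne_of_gt ht)) hright
    exact h0₂ (by linarith)
  · have hT : Tendsto (fun T : ℝ => -T) (𝓝 Tc) (𝓝 (-Tc)) := tendsto_neg Tc
    exact ⟨_, _, (hT.mono_left nhdsWithin_le_nhds).mul hleft,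
      (hT.mono_left nhdsWithin_le_nhds).mul hright, by ring⟩

/-! ### The transition for functions in `W` -/

/-- For `Tc ≤ 0` condition (C) is vacuous, so that its `v` is not unique. -/
theorem pos_of_mem_WSet {ε Λ U₁ U₂ Tc : ℝ} {u : ℝ → ℝ → ℝ} (hεΛ : ε < Λ)
    (hu : u ∈ WSet ε Λ U₁ U₂ Tc) : 0 < Tc := by
  obtain ⟨-, -, -, v, w, ⟨hv, hw, hpos, -, -⟩, huniq⟩ := hu
  by_contra hTc
  have hempty : ∀ T, T ∉ Ioo 0 Tc := fun T hT => hTc (hT.1.trans hT.2)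
  have h := (huniq (fun x => v x + 1) w ⟨hv.add continuousOn_const, hw,
    fun x hx => by linarith [hpos x hx],
    fun _ _ => ⟨1, one_pos, fun T hT => absurd hT (hempty T)⟩,
    fun _ _ => ⟨1, one_pos, fun T hT => absurd hT (hempty T)⟩⟩).1 (left_mem_Icc.2 hεΛ.le)
  simp at h

theorem transition_of_conditionC {ε Λ μ Tc : ℝ} {N : ℝ → ℝ} {u : ℝ → ℝ → ℝ} {v w : ℝ → ℝ}
    (hε : 0 < ε) (hεΛ : ε < Λ) (hΛμ : Λ < μ) (hTc : 0 < Tc) (hN : ContinuousOn N (Ici (-μ)))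
    (hN₀ : 0 < N 0) (hO : N =O[atTop] Real.sqrt)
    (hu : ContinuousOn (Function.uncurry u) (Icc 0 Tc ×ˢ Icc ε Λ))
    (hu₂ : ContDiffOn ℝ 2 (Function.uncurry u) (Ioo 0 Tc ×ˢ Icc ε Λ))
    (hC : ConditionC ε Λ Tc u v w) :
    IsSecondOrderTransition (Omega ε Λ μ N Tc u) Tc ∧
      HasSpecificHeatGap (Omega ε Λ μ N Tc u) Tc (gapFormula ε Λ (N 0) Tc v) ∧
      0 < gapFormula ε Λ (N 0) Tc v := by
  obtain ⟨Ψ₁, Ψ₂, h₁, h₂, hc, hc₁, hc₂, h0, h0₁, hgap⟩ :=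
    exists_derivs_Psi (N := N) hε hεΛ hTc hu hu₂ hC
  have hpos := gapFormula_pos hε hεΛ hTc hN₀ hC.1 hC.2.2.1
  have h0₂ : Ψ₂ Tc ≠ 0 := fun h => by simp [hgap, h] at hpos
  have h := secondOrderTransition_of_cutoff (Ω := Omega ε Λ μ N Tc u) hTc
    (contDiffOn_OmegaN hε hεΛ hΛμ hN hO)
    (fun T => by unfold Omega cutoff; split_ifs <;> simp) h₁ h₂ hc hc₁ hc₂ h0 h0₁ h0₂
  exact ⟨h.1, hgap ▸ h.2, hpos⟩

end BCS

theorem mainTheorem5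
    (ε hbar ωD μ U₁ U₂ Tc : ℝ) (U : ℝ → ℝ → ℝ) (N : ℝ → ℝ)
    (hε : 0 < ε) (hhbar : 0 < hbar) (hωD : 0 < ωD)
    (hεΛ : ε < hbar * ωD) (hΛμ : hbar * ωD < μ)
    (hU₁ : 0 < U₁) (hU₁₂ : U₁ < U₂)
    (hτ₁ : ∃ τ₁, BCS.IsSimpleTransitionTemp ε (hbar * ωD) U₁ τ₁)
    (hU : BCS.PotentialCondition ε (hbar * ωD) U₁ U₂ U)
    (hN_nonneg : ∀ x ∈ Set.Ici (-μ), 0 ≤ N x)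
    (hN_cont : ContinuousOn N (Set.Ici (-μ)))
    (hN_zero : 0 < N 0)
    (hN_growth : N =O[Filter.atTop] Real.sqrt)
    (hTc : Tc = BCS.transitionTemp ε (hbar * ωD) U₁ U₂ U) :
    (∀ u ∈ BCS.WSet ε (hbar * ωD) U₁ U₂ Tc,
      BCS.IsSecondOrderTransition (BCS.Omega ε (hbar * ωD) μ N Tc u) Tc ∧
      ∀ v w : ℝ → ℝ, BCS.ConditionC ε (hbar * ωD) Tc u v w →
        BCS.HasSpecificHeatGap (BCS.Omega ε (hbar * ωD) μ N Tc u) Tc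
          (BCS.gapFormula ε (hbar * ωD) (N 0) Tc v) ∧
        0 < BCS.gapFormula ε (hbar * ωD) (N 0) Tc v) ∧
    (∀ u₀ : ℝ → ℝ → ℝ,
      (∀ T ∈ Set.Icc 0 Tc, BCS.IsGapFunctionAt ε (hbar * ωD) U₁ U₂ U T (u₀ T)) →
      u₀ ∈ BCS.WSet ε (hbar * ωD) U₁ U₂ Tc →
      BCS.IsSecondOrderTransition (BCS.Omega ε (hbar * ωD) μ N Tc u₀) Tc) := by
  have key : ∀ u ∈ BCS.WSet ε (hbar * ωD) U₁ U₂ Tc,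
      BCS.IsSecondOrderTransition (BCS.Omega ε (hbar * ωD) μ N Tc u) Tc ∧
      ∀ v w : ℝ → ℝ, BCS.ConditionC ε (hbar * ωD) Tc u v w →
        BCS.HasSpecificHeatGap (BCS.Omega ε (hbar * ωD) μ N Tc u) Tc
          (BCS.gapFormula ε (hbar * ωD) (N 0) Tc v) ∧
        0 < BCS.gapFormula ε (hbar * ωD) (N 0) Tc v := by
    intro u hu
    have hTc_pos := BCS.pos_of_mem_WSet hεΛ hu
    obtain ⟨hcont, hC2, -, v₀, w₀, hC₀, -⟩ := hu
    have h := fun v w (hC : BCS.ConditionC ε (hbar * ωD) Tc u v w) =>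
      BCS.transition_of_conditionC hε hεΛ hΛμ hTc_pos hN_cont hN_zero hN_growth hcont hC2 hC
    exact ⟨(h v₀ w₀ hC₀).1, fun v w hC => (h v w hC).2⟩
  exact ⟨key, fun u₀ _ hu₀ => (key u₀ hu₀).1⟩
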